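/- **Proposition 2.2.** Let $n\ge 1$ and let $(W_n,S_n)$ be the Coxeter system of type $B_n$, with $S_n=\{t,s_1,\dots,s_{n-1}\}$, where $ts_1$ has order $4$ (if $n\ge2$), $s_is_{i+1}$ has order $3$, and all other pairs of distinct generators commute. Let $\ell$ be the length function, let $\ell_t(w)$ be the number of occurrences of $t$ in a reduced expression of $w$ (it does not depend on the reduced expression), and put $\ell_s=\ell-\ell_t$. Let $\Gamma=\mathbb Z^2$, ordered lexicographically, let $A=\mathbb Z[\Gamma]=\bigoplus_{\gamma\in\Gamma}\mathbb Z v^\gamma$, $V=v^{(1,0)}$, $v=v^{(0,1)}$ (so $A=\mathbb Z[V^{\pm1},v^{\pm1}]$), and let $A_{<0}=\bigoplus_{\gamma<0}\mathbb Z v^\gamma$. Put $L(w)=(\ell_t(w),\ell_s(w))\in\Gamma$. Let $\mathcal H_n$ be the Hecke algebra of $(W_n,S_n,L)$: the associative $A$-algebra with $A$-basis $(T_w)_{w\in W_n}$ and multiplication determined by $T_wT_{w'}=T_{ww'}$ if $\ell(ww')=\ell(w)+\ell(w')$, and $T_s^2=1+(v^{L(s)}-v^{-L(s)})T_s$ for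 $s\in S_n$. Let $\mathcal H(\mathfrak S_n)$ be the $A$-subalgebra of $\mathcal H_n$ generated by $T_{s_1},\dots,T_{s_{n-1}}$. Let $a\mapsto\bar a$ be the ring automorphism of $A$ with $\overline{v^\gamma}=v^{-\gamma}$, and put $\overline{\sum_w a_wT_w}=\sum_w\overline{a_w}\,T_{w^{-1}}^{-1}$. For $w\in W_n$ let $C_w$ be the Kazhdan–Lusztig element, that is, the unique element of $\mathcal H_n$ with $\overline{C_w}=C_w$ and $C_w\in T_w+\bigoplus_{y\in W_n}A_{<0}T_y$. Let $\mathcal C_n$ be the $A$-submodule of $\mathcal H_n$ spanned by the $C_w$ with $\ell_t(w)=n$. For $h\in\mathcal H_n$ the following are equivalent: 1. $h\in\mathcal C_n$; 2. $(T_t-V)\,x\,h=0$ for all $x\in\mathcal H_n$; 3. $(T_t-V)\,x\,h=0$ for all $x\in\mathcal H(\mathfrak S_n)$. -/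

import Mathlib

namespace CoxeterHecke

section Exchange

variable {B W : Type*} [Group W] {M : CoxeterMatrix B} (cs : CoxeterSystem M W)

open Classical in
/-- The involution of `W × ℤ/2` attached to a simple reflection `s`:
`(r, e) ↦ (s r s, e + [r = s])`. -/
noncomputable def reflFlip (i : B) : Equiv.Perm (W × ZMod 2) where
  toFun p := (cs.simple i * p.1 * cs.simple i, p.2 + if p.1 = cs.simple i then 1 else 0)
  invFun p := (cs.simple i * p.1 * cs.simple i, p.2 + if p.1 = cs.simple i then 1 else 0)
  left_inv := by
    rintro ⟨r, e⟩
    have h : cs.simple i * r * cs.simple i = cs.simple i ↔ r = cs.simple i := by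
      constructor
      · intro h
        have h1 := congrArg (fun x => cs.simple i * x) h
        simp only [mul_assoc, cs.simple_mul_simple_cancel_left, cs.simple_mul_simple_self] at h1
        calc r = r * cs.simple i * cs.simple i := by simp
          _ = cs.simple i := by rw [h1]; simp
      · rintro rfl; simp
    ext
    · simp [mul_assoc]
    · simp only [h, add_assoc, CharTwo.add_self_eq_zero, add_zero]
  right_inv := by
    rintro ⟨r, e⟩
    have h : cs.simple i * r * cs.simple i = cs.simple i ↔ r = cs.simple i := by
      constructor
      · intro h
        have h1 := congrArg (fun x => cs.simple i * x) h
        simp only [mul_assoc, cs.simple_mul_simple_cancel_left, cs.simple_mul_simple_self] at h1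
        calc r = r * cs.simple i * cs.simple i := by simp
          _ = cs.simple i := by rw [h1]; simp
      · rintro rfl; simp
    ext
    · simp [mul_assoc]
    · simp only [h, add_assoc, CharTwo.add_self_eq_zero, add_zero]

open Classical in
theorem reflFlip_apply (i : B) (r : W) (e : ZMod 2) :
    reflFlip cs i (r, e) =
      (cs.simple i * r * cs.simple i, e + if r = cs.simple i then 1 else 0) := rfl

theorem simple_mul_pow (i j : B) (k : ℕ) :
    ((cs.simple i * cs.simple j) ^ k)⁻¹ * cs.simple j =
      cs.simple j * (cs.simple i * cs.simple j) ^ k := by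
  have h : SemiconjBy (cs.simple j) (cs.simple i * cs.simple j)
      (cs.simple i * cs.simple j)⁻¹ := by
    simp [SemiconjBy, mul_assoc]
  have := (h.pow_right k).eq
  rw [this, inv_pow]

open Classical in
theorem reflFlip_mul_pow (i j : B) (m : ℕ) (r : W) (e : ZMod 2) :
    ((reflFlip cs i * reflFlip cs j) ^ m) (r, e) =
      ((cs.simple i * cs.simple j) ^ m * r * ((cs.simple i * cs.simple j) ^ m)⁻¹,
        e + ∑ k ∈ Finset.range (2 * m),
          if r = ((cs.simple i * cs.simple j) ^ k)⁻¹ * cs.simple j then 1 else 0) := by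
  induction m with
  | zero => simp
  | succ m ih =>
    rw [pow_succ', Equiv.Perm.mul_apply, ih, Equiv.Perm.mul_apply, reflFlip_apply, reflFlip_apply]
    set u := cs.simple i * cs.simple j with hu
    have hj : cs.simple j * u = u⁻¹ * cs.simple j := by
      have := simple_mul_pow cs i j 1
      simp only [pow_one] at this
      exact this.symm
    have key1 : (u ^ m * r * (u ^ m)⁻¹ = cs.simple j) ↔
        r = (u ^ (2 * m))⁻¹ * cs.simple j := by
      rw [mul_inv_eq_iff_eq_mul, ← simple_mul_pow cs i j m, ← hu, ← eq_inv_mul_iff_mul_eq,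
        ← mul_assoc, two_mul, pow_add, mul_inv_rev]
    have key2 : (cs.simple j * (u ^ m * r * (u ^ m)⁻¹) * cs.simple j = cs.simple i) ↔
        r = (u ^ (2 * m + 1))⁻¹ * cs.simple j := by
      have h1 : (cs.simple j * (u ^ m * r * (u ^ m)⁻¹) * cs.simple j = cs.simple i) ↔
          u ^ m * r * (u ^ m)⁻¹ = u⁻¹ * cs.simple j := by
        constructor
        · intro h
          have h2 := congrArg (fun x => cs.simple j * x * cs.simple j) h
          simp only [mul_assoc, cs.simple_mul_simple_self, cs.simple_mul_simple_cancel_left,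
            mul_one] at h2
          rw [hu, mul_inv_rev, cs.inv_simple, cs.inv_simple, mul_assoc, mul_assoc, h2]
        · intro h
          rw [h, hu]
          simp [mul_assoc]
      rw [h1, mul_inv_eq_iff_eq_mul, mul_assoc, ← simple_mul_pow cs i j m, ← hu,
        ← eq_inv_mul_iff_mul_eq, ← mul_assoc, ← mul_assoc,
        show u ^ (2 * m + 1) = u ^ m * (u * u ^ m) by
          rw [← pow_succ', ← pow_add]; congr 1; ring]
      simp only [mul_inv_rev, mul_assoc]
    ext
    · simp only [pow_succ', mul_inv_rev, mul_assoc, hu, cs.inv_simple]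
    · rw [show 2 * (m + 1) = 2 * m + 1 + 1 by ring, Finset.sum_range_succ, Finset.sum_range_succ]
      simp only [key1, key2, add_assoc]

theorem reflFlip_liftable : M.IsLiftable (reflFlip cs) := by
  classical
  intro i j
  ext1 ⟨r, e⟩
  rw [reflFlip_mul_pow, cs.simple_mul_simple_pow, two_mul, Finset.sum_range_add]
  simp only [pow_add, cs.simple_mul_simple_pow, one_mul]
  simp [CharTwo.add_self_eq_zero]

open Classical in
theorem lift_reflFlip_wordProd (ω : List B) (r : W) (e : ZMod 2) :
    cs.lift ⟨reflFlip cs, reflFlip_liftable cs⟩ (cs.wordProd ω) (r, e) =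
      (cs.wordProd ω * r * (cs.wordProd ω)⁻¹, e + ((cs.rightInvSeq ω).count r : ℕ)) := by
  induction ω with
  | nil => simp
  | cons i ω ih =>
    rw [cs.wordProd_cons, map_mul, Equiv.Perm.mul_apply, ih, cs.lift_apply_simple, reflFlip_apply]
    have h : (cs.wordProd ω * r * (cs.wordProd ω)⁻¹ = cs.simple i) ↔
        (cs.wordProd ω)⁻¹ * cs.simple i * cs.wordProd ω = r := by
      rw [mul_inv_eq_iff_eq_mul, mul_assoc, inv_mul_eq_iff_eq_mul]
      exact eq_comm
    ext
    · simp [mul_assoc]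
    · simp only [CoxeterSystem.rightInvSeq, List.count_cons, h, add_assoc, beq_iff_eq]
      split_ifs <;> simp

/-- Reduced words of the same element have the same right inversions. -/
theorem rightInvSeq_perm {ω ω' : List B} (h : cs.IsReduced ω) (h' : cs.IsReduced ω')
    (hw : cs.wordProd ω = cs.wordProd ω') :
    (cs.rightInvSeq ω).Perm (cs.rightInvSeq ω') := by
  classical
  rw [List.perm_iff_count]
  intro r
  have e1 := lift_reflFlip_wordProd cs ω r 0
  have e2 := lift_reflFlip_wordProd cs ω' r 0
  rw [hw, e2] at e1
  have e3 := (Prod.ext_iff.mp e1).2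
  simp only [zero_add] at e3
  have b1 := List.nodup_iff_count_le_one.mp (h.nodup_rightInvSeq cs) r
  have b2 := List.nodup_iff_count_le_one.mp (h'.nodup_rightInvSeq cs) r
  have e4 := (ZMod.natCast_eq_natCast_iff' _ _ _).mp e3
  omega

/-- If `s w > w`, `w s' > w` and `s w s' < s w`, then `s w = w s'`. -/
theorem exchange {w : W} {i j : B} (h1 : cs.length w < cs.length (cs.simple i * w))
    (h2 : cs.length w < cs.length (w * cs.simple j))
    (h3 : cs.length (cs.simple i * w * cs.simple j) < cs.length (cs.simple i * w)) :
    cs.simple i * w = w * cs.simple j := by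
  obtain ⟨ω, hω, rfl⟩ := cs.exists_isReduced w
  obtain ⟨ω', hω', hx⟩ := cs.exists_isReduced (cs.simple i * cs.wordProd ω * cs.simple j)
  have e1 : cs.length (cs.simple i * cs.wordProd ω) = cs.length (cs.wordProd ω) + 1 := by
    rcases cs.length_simple_mul (cs.wordProd ω) i with h | h <;> omega
  have r1 : cs.IsReduced (i :: ω) := by
    rw [CoxeterSystem.IsReduced, cs.wordProd_cons, e1, hω.eq, List.length_cons]
  have e2 : cs.length (cs.simple i * cs.wordProd ω * cs.simple j) + 1
      = cs.length (cs.simple i * cs.wordProd ω) := by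
    rcases cs.length_mul_simple (cs.simple i * cs.wordProd ω) j with h | h <;> omega
  have p2 : cs.wordProd (ω'.concat j) = cs.simple i * cs.wordProd ω := by
    rw [cs.wordProd_concat, ← hx]; simp
  have r2 : cs.IsReduced (ω'.concat j) := by
    rw [CoxeterSystem.IsReduced, p2, ← e2, hx, hω'.eq]; simp
  have hp := rightInvSeq_perm cs r2 r1 (by rw [p2, cs.wordProd_cons])
  have hmem : cs.simple j ∈ cs.rightInvSeq (i :: ω) := by
    apply hp.subset
    rw [cs.rightInvSeq_concat]; simp
  rw [CoxeterSystem.rightInvSeq, List.mem_cons] at hmem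
  rcases hmem with h | h
  · rw [h]; simp [mul_assoc]
  · have := (cs.isRightInversion_of_mem_rightInvSeq hω h).2
    omega

end Exchange

/-- A positive weight function on a Coxeter group, with values in a totally ordered abelian
group `Γ`: `L(ww') = L(w) + L(w')` whenever `ℓ(ww') = ℓ(w) + ℓ(w')`, and `L(s) > 0`. -/
structure WeightFunction {B W : Type*} [Group W] {M : CoxeterMatrix B}
    (cs : CoxeterSystem M W) (Γ : Type*) [AddCommGroup Γ] [LinearOrder Γ] where
  toFun : W → Γ
  map_mul' : ∀ w w' : W, cs.length (w * w') = cs.length w + cs.length w' →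
    toFun (w * w') = toFun w + toFun w'
  pos' : ∀ i : B, 0 < toFun (cs.simple i)

section Ground

variable (Γ : Type*)

/-- The group algebra of `Γ` over `ℤ`. -/
abbrev Ground [AddCommGroup Γ] := AddMonoidAlgebra ℤ Γ

variable {Γ} [AddCommGroup Γ]

/-- The basis element `v^γ` of the group algebra. -/
noncomputable def vpow (γ : Γ) : Ground Γ := AddMonoidAlgebra.single γ 1

/-- The ring automorphism of the group algebra with `v^γ ↦ v^(-γ)`. -/
noncomputable def groundBar : Ground Γ →+* Ground Γ :=
  AddMonoidAlgebra.mapDomainRingHom ℤ (negAddMonoidHom : Γ →+ Γ)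

/-- `a` lies in `A_{<0}`: only exponents `γ < 0` occur in `a`. -/
def IsNegative [LinearOrder Γ] (a : Ground Γ) : Prop :=
  ∀ γ : Γ, a.coeff γ ≠ 0 → γ < 0

end Ground

section Hecke

variable {B W Γ : Type*} [Group W] {M : CoxeterMatrix B} (cs : CoxeterSystem M W)
  [AddCommGroup Γ] [LinearOrder Γ]

theorem WeightFunction.simple_eq {cs : CoxeterSystem M W} (L : WeightFunction cs Γ)
    {w : W} {i j : B} (h : cs.simple i * w = w * cs.simple j) :
    L.toFun (cs.simple i) = L.toFun (cs.simple j) := by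
  have main : ∀ w : W, cs.simple i * w = w * cs.simple j →
      cs.length (cs.simple i * w) = cs.length w + 1 →
      L.toFun (cs.simple i) = L.toFun (cs.simple j) := by
    intro w h hl
    have a1 := L.map_mul' (cs.simple i) w (by rw [hl, cs.length_simple]; omega)
    have a2 := L.map_mul' w (cs.simple j) (by rw [← h, hl, cs.length_simple])
    rw [h, a2, add_comm] at a1
    exact (add_right_cancel a1).symm
  rcases cs.length_simple_mul w i with hl | hl
  · exact main w h hl
  · refine main (cs.simple i * w) ?_ ?_
    · rw [mul_assoc, ← h]
    · simpa using hl.symm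

/-- The Hecke algebra of `(W, S, L)`: as a module over the group algebra `A` of `Γ`,
it is free with basis indexed by `W`. The multiplication is constructed below from the
left regular representation; `T_mul_T` and `T_simple_sq` are its two defining relations. -/
def Hecke (_L : WeightFunction cs Γ) : Type _ := W →₀ Ground Γ

variable {cs} (L : WeightFunction cs Γ)

namespace Hecke

noncomputable instance instAddCommGroup : AddCommGroup (Hecke cs L) :=
  inferInstanceAs (AddCommGroup (W →₀ Ground Γ))

noncomputable instance instModule : Module (Ground Γ) (Hecke cs L) :=
  inferInstanceAs (Module (Ground Γ) (W →₀ Ground Γ))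

/-- The standard basis `(T_w)` of the Hecke algebra. -/
noncomputable def basis : Module.Basis W (Ground Γ) (Hecke cs L) :=
  Module.Basis.ofRepr (LinearEquiv.refl (Ground Γ) (W →₀ Ground Γ))

/-- The basis element `T_w`. -/
noncomputable def T (w : W) : Hecke cs L := basis L w

/-- The parameter `v^{L(s)} - v^{-L(s)}`. -/
noncomputable def xi (i : B) : Ground Γ :=
  vpow (L.toFun (cs.simple i)) - vpow (-L.toFun (cs.simple i))

theorem xi_eq {w : W} {i j : B} (h : cs.simple i * w = w * cs.simple j) :
    xi L i = xi L j := by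
  rw [xi, xi, L.simple_eq h]

/-- Left multiplication by `T_s`. -/
noncomputable def lmul (i : B) : Module.End (Ground Γ) (Hecke cs L) :=
  (basis L).constr ℤ fun w =>
    if cs.length w < cs.length (cs.simple i * w) then T L (cs.simple i * w)
    else T L (cs.simple i * w) + xi L i • T L w

/-- Right multiplication by `T_s`. -/
noncomputable def rmul (i : B) : Module.End (Ground Γ) (Hecke cs L) :=
  (basis L).constr ℤ fun w =>
    if cs.length w < cs.length (w * cs.simple i) then T L (w * cs.simple i)
    else T L (w * cs.simple i) + xi L i • T L w

theorem lmul_up {i : B} {w : W} (h : cs.length w < cs.length (cs.simple i * w)) :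
    lmul L i (T L w) = T L (cs.simple i * w) := by
  rw [lmul, T, Module.Basis.constr_basis, if_pos h]

theorem lmul_down {i : B} {w : W} (h : cs.length (cs.simple i * w) < cs.length w) :
    lmul L i (T L w) = T L (cs.simple i * w) + xi L i • T L w := by
  rw [lmul, T, Module.Basis.constr_basis, if_neg (by omega)]; rfl

theorem rmul_up {i : B} {w : W} (h : cs.length w < cs.length (w * cs.simple i)) :
    rmul L i (T L w) = T L (w * cs.simple i) := by
  rw [rmul, T, Module.Basis.constr_basis, if_pos h]

theorem rmul_down {i : B} {w : W} (h : cs.length (w * cs.simple i) < cs.length w) :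
    rmul L i (T L w) = T L (w * cs.simple i) + xi L i • T L w := by
  rw [rmul, T, Module.Basis.constr_basis, if_neg (by omega)]; rfl

theorem lmul_rmul (i j : B) : Commute (lmul L i) (rmul L j) := by
  apply (basis L).ext
  intro w
  change lmul L i (rmul L j (T L w)) = rmul L j (lmul L i (T L w))
  have A1 := cs.length_simple_mul w i
  have A2 := cs.length_mul_simple w j
  have A3 := cs.length_simple_mul (w * cs.simple j) i
  have A4 := cs.length_mul_simple (cs.simple i * w) j
  rw [← mul_assoc] at A3
  have ss : cs.simple i * (cs.simple i * w) = w := by simp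
  have tt : w * cs.simple j * cs.simple j = w := by simp
  have tt2 : cs.simple i * w * cs.simple j * cs.simple j = cs.simple i * w := by simp
  rcases A1 with A1 | A1 <;> rcases A2 with A2 | A2
  · rw [rmul_up L (w := w) (i := j) (by omega), lmul_up L (w := w) (i := i) (by omega)]
    rcases A3 with A3 | A3
    · rw [lmul_up L (w := w * cs.simple j) (i := i) (by rw [← mul_assoc]; omega),
        rmul_up L (w := cs.simple i * w) (i := j) (by omega), mul_assoc]
    · have e := exchange cs (w := w) (i := i) (j := j) (by omega) (by omega) (by omega)
      rw [← e, lmul_down L (w := cs.simple i * w) (i := i) (by rw [ss]; omega), ss, e,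
        rmul_down L (w := w * cs.simple j) (i := j) (by rw [tt]; omega), tt, xi_eq L e]
  · rw [rmul_down L (w := w) (i := j) (by omega), lmul_up L (w := w) (i := i) (by omega),
      map_add, map_smul, lmul_up L (w := w) (i := i) (by omega),
      lmul_up L (w := w * cs.simple j) (i := i) (by rw [← mul_assoc]; omega),
      rmul_down L (w := cs.simple i * w) (i := j) (by omega), mul_assoc]
  · rw [rmul_up L (w := w) (i := j) (by omega), lmul_down L (w := w) (i := i) (by omega),
      map_add, map_smul, rmul_up L (w := w) (i := j) (by omega),
      rmul_up L (w := cs.simple i * w) (i := j) (by omega),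
      lmul_down L (w := w * cs.simple j) (i := i) (by rw [← mul_assoc]; omega), mul_assoc]
  · rw [rmul_down L (w := w) (i := j) (by omega), lmul_down L (w := w) (i := i) (by omega),
      map_add, map_add, map_smul, map_smul, lmul_down L (w := w) (i := i) (by omega),
      rmul_down L (w := w) (i := j) (by omega)]
    rcases A3 with A3 | A3
    · have e := exchange cs (w := cs.simple i * w) (i := i) (j := j)
        (by rw [ss]; omega) (by omega) (by rw [ss]; omega)
      rw [ss] at e
      have e2 : w * cs.simple j = cs.simple i * w := by
        calc w * cs.simple j = cs.simple i * w * cs.simple j * cs.simple j := by rw [← e]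
          _ = _ := tt2
      rw [xi_eq L e2.symm, e2, lmul_up L (w := cs.simple i * w) (i := i) (by rw [ss]; omega),
        rmul_up L (w := cs.simple i * w) (i := j) (by omega), ss, ← e]
    · rw [lmul_down L (w := w * cs.simple j) (i := i) (by rw [← mul_assoc]; omega),
        rmul_down L (w := cs.simple i * w) (i := j) (by omega), mul_assoc]
      simp only [smul_add, smul_smul, mul_comm (xi L i) (xi L j)]
      abel

/-- A reduced word of `w`. -/
noncomputable def redWord (cs : CoxeterSystem M W) (w : W) : List B :=
  Classical.choose (cs.exists_isReduced w)

theorem redWord_isReduced (cs : CoxeterSystem M W) (w : W) : cs.IsReduced (redWord cs w) :=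
  (Classical.choose_spec (cs.exists_isReduced w)).1

theorem redWord_prod (cs : CoxeterSystem M W) (w : W) : cs.wordProd (redWord cs w) = w :=
  (Classical.choose_spec (cs.exists_isReduced w)).2.symm

/-- The algebra of operators generated by the left multiplications. -/
noncomputable def ops : Subalgebra (Ground Γ) (Module.End (Ground Γ) (Hecke cs L)) :=
  Algebra.adjoin (Ground Γ) (Set.range (lmul L))

theorem word_apply (ω : List B) (w : W)
    (h : cs.length (cs.wordProd ω * w) = ω.length + cs.length w) :
    (ω.map (lmul L)).prod (T L w) = T L (cs.wordProd ω * w) := by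
  induction ω with
  | nil => simp
  | cons i ω ih =>
    rw [cs.wordProd_cons, mul_assoc, List.length_cons] at h
    have h1 := cs.length_mul_le (cs.wordProd ω) w
    have h2 := cs.length_wordProd_le ω
    have h3 := cs.length_simple_mul (cs.wordProd ω * w) i
    rw [List.map_cons, List.prod_cons, Module.End.mul_apply, ih (by omega),
      lmul_up L (by omega), cs.wordProd_cons, mul_assoc]

theorem word_apply_one (ω : List B) (h : cs.IsReduced ω) :
    (ω.map (lmul L)).prod (T L 1) = T L (cs.wordProd ω) := by
  simpa using word_apply L ω 1 (by simpa using h.eq)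

theorem word_apply_one_right (ω : List B) (h : cs.IsReduced ω) :
    (ω.reverse.map (rmul L)).prod (T L 1) = T L (cs.wordProd ω) := by
  induction ω using List.reverseRecOn with
  | nil => simp
  | append_singleton ω i ih =>
    have h1 : cs.length (cs.wordProd ω * cs.simple i) = ω.length + 1 := by
      simpa [CoxeterSystem.IsReduced, cs.wordProd_append] using h
    have h2 := cs.length_wordProd_le ω
    have h3 := cs.length_mul_simple (cs.wordProd ω) i
    have hr : cs.IsReduced ω := by
      rw [CoxeterSystem.IsReduced]; omega
    rw [List.reverse_append, List.map_append, List.prod_append, Module.End.mul_apply, ih hr]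
    simp only [List.reverse_singleton, List.map_singleton, List.prod_singleton]
    rw [rmul_up L (by omega)]
    simp [cs.wordProd_append]

theorem ops_commute {f : Module.End (Ground Γ) (Hecke cs L)} (hf : f ∈ ops L) (j : B) :
    Commute f (rmul L j) := by
  induction hf using Algebra.adjoin_induction with
  | mem x hx => obtain ⟨i, rfl⟩ := hx; exact lmul_rmul L i j
  | algebraMap r => exact Algebra.commute_algebraMap_left r _
  | add x y _ _ hx hy => exact hx.add_left hy
  | mul x y _ _ hx hy => exact hx.mul_left hy

/-- An operator of the algebra is determined by its value at `T_1`. -/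
theorem ops_ext {f g : Module.End (Ground Γ) (Hecke cs L)} (hf : f ∈ ops L) (hg : g ∈ ops L)
    (h : f (T L 1) = g (T L 1)) : f = g := by
  apply (basis L).ext
  intro w
  change f (T L w) = g (T L w)
  have hc : ∀ k ∈ ops L, k (T L w) =
      (((redWord cs w).reverse.map (rmul L)).prod) (k (T L 1)) := by
    intro k hk
    have hcomm : Commute k (((redWord cs w).reverse.map (rmul L)).prod) := by
      apply Commute.list_prod_right
      intro x hx
      obtain ⟨j, _, rfl⟩ := List.mem_map.mp hx
      exact ops_commute L hk j
    have := word_apply_one_right L (redWord cs w) (redWord_isReduced cs w)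
    rw [redWord_prod] at this
    rw [← this, ← Module.End.mul_apply, hcomm.eq, Module.End.mul_apply]
  rw [hc f hf, hc g hg, h]

/-- Left multiplication by an element of the Hecke algebra: the `A`-linear extension of
`T_w ↦ T_{s_1} ⋯ T_{s_k}` with `w = s_1 ⋯ s_k` reduced. -/
noncomputable def leftMul : Hecke cs L →ₗ[Ground Γ] Module.End (Ground Γ) (Hecke cs L) :=
  (basis L).constr ℤ fun w => ((redWord cs w).map (lmul L)).prod

theorem leftMul_T (w : W) : leftMul L (T L w) = ((redWord cs w).map (lmul L)).prod := by
  rw [leftMul, T, Module.Basis.constr_basis]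

theorem leftMul_mem (h : Hecke cs L) : leftMul L h ∈ ops L := by
  have hs : h ∈ Submodule.span (Ground Γ) (Set.range (basis L)) := by
    rw [(basis L).span_eq]; trivial
  induction hs using Submodule.span_induction with
  | mem x hx =>
    obtain ⟨w, rfl⟩ := hx
    change leftMul L (T L w) ∈ _
    rw [leftMul_T]
    apply list_prod_mem
    intro x hx
    obtain ⟨j, _, rfl⟩ := List.mem_map.mp hx
    exact Algebra.subset_adjoin ⟨j, rfl⟩
  | zero => rw [map_zero]; exact zero_mem _
  | add x y _ _ hx hy => rw [map_add]; exact add_mem hx hy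
  | smul a x _ hx => rw [map_smul]; exact Subalgebra.smul_mem _ hx a

theorem leftMul_apply_one (h : Hecke cs L) : leftMul L h (T L 1) = h := by
  have : (LinearMap.applyₗ (T L 1)).comp (leftMul L) = LinearMap.id := by
    apply (basis L).ext
    intro w
    change leftMul L (T L w) (T L 1) = T L w
    rw [leftMul_T, word_apply_one L _ (redWord_isReduced cs w), redWord_prod]
  exact LinearMap.congr_fun this h

theorem leftMul_one : leftMul L (T L 1) = 1 :=
  ops_ext L (leftMul_mem L _) (one_mem _) (leftMul_apply_one L _)

theorem leftMul_leftMul (x y : Hecke cs L) :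
    leftMul L (leftMul L x y) = leftMul L x * leftMul L y :=
  ops_ext L (leftMul_mem L _) (mul_mem (leftMul_mem L _) (leftMul_mem L _)) (by
    rw [leftMul_apply_one, Module.End.mul_apply, leftMul_apply_one])

noncomputable instance instRing : Ring (Hecke cs L) where
  __ := instAddCommGroup L
  mul x y := leftMul L x y
  one := T L 1
  left_distrib x y z := map_add (leftMul L x) y z
  right_distrib x y z := by
    change leftMul L (x + y) z = leftMul L x z + leftMul L y z
    rw [map_add, LinearMap.add_apply]
  zero_mul x := by
    change leftMul L 0 x = 0
    rw [map_zero, LinearMap.zero_apply]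
  mul_zero x := map_zero (leftMul L x)
  mul_assoc x y z := by
    change leftMul L (leftMul L x y) z = leftMul L x (leftMul L y z)
    rw [leftMul_leftMul, Module.End.mul_apply]
  one_mul x := by
    change leftMul L (T L 1) x = x
    rw [leftMul_one, Module.End.one_apply]
  mul_one x := leftMul_apply_one L x

theorem mul_def (x y : Hecke cs L) : x * y = leftMul L x y := rfl

theorem one_def : (1 : Hecke cs L) = T L 1 := rfl

noncomputable instance instAlgebra : Algebra (Ground Γ) (Hecke cs L) :=
  Algebra.ofModule
    (fun a x y => by rw [mul_def, mul_def, map_smul, LinearMap.smul_apply])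
    (fun a x y => by rw [mul_def, mul_def, map_smul])

theorem T_simple_mul (i : B) (x : Hecke cs L) : T L (cs.simple i) * x = lmul L i x := by
  rw [mul_def, ops_ext L (leftMul_mem L _) (Algebra.subset_adjoin ⟨i, rfl⟩)
    (g := lmul L i)]
  rw [leftMul_apply_one, lmul_up L (by simp), mul_one]

/-- First defining relation: `T_w T_{w'} = T_{ww'}` if `ℓ(ww') = ℓ(w) + ℓ(w')`. -/
theorem T_mul_T {w w' : W} (h : cs.length (w * w') = cs.length w + cs.length w') :
    T L w * T L w' = T L (w * w') := by
  rw [mul_def, leftMul_T, word_apply, redWord_prod]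
  rw [redWord_prod, h, ← (redWord_isReduced cs w).eq, redWord_prod]

/-- Second defining relation: `T_s² = 1 + (v^{L(s)} - v^{-L(s)}) T_s`. -/
theorem T_simple_sq (i : B) :
    T L (cs.simple i) ^ 2 = 1 + (vpow (L.toFun (cs.simple i)) - vpow (-L.toFun (cs.simple i))) •
      T L (cs.simple i) := by
  rw [pow_two, T_simple_mul, lmul_down L (by simp), cs.simple_mul_simple_self]
  rfl

theorem isUnit_T_simple (i : B) : IsUnit (T L (cs.simple i)) := by
  have h := T_simple_sq L i
  rw [pow_two] at h
  refine ⟨⟨T L (cs.simple i), T L (cs.simple i) - xi L i • 1, ?_, ?_⟩, rfl⟩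
  · rw [mul_sub, h, mul_smul_comm, mul_one, xi, add_sub_cancel_right]
  · rw [sub_mul, h, smul_mul_assoc, one_mul, xi, add_sub_cancel_right]

theorem isUnit_T (w : W) : IsUnit (T L w) := by
  obtain ⟨ω, hω, rfl⟩ := cs.exists_isReduced w
  induction ω with
  | nil => rw [cs.wordProd_nil, ← one_def]; exact isUnit_one
  | cons i ω ih =>
    have h1 : cs.length (cs.simple i * cs.wordProd ω) = ω.length + 1 := by
      simpa [CoxeterSystem.IsReduced, cs.wordProd_cons] using hω
    have h2 := cs.length_wordProd_le ω
    have h3 := cs.length_simple_mul (cs.wordProd ω) i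
    have hr : cs.IsReduced ω := by
      rw [CoxeterSystem.IsReduced]; omega
    rw [cs.wordProd_cons, ← T_mul_T L (by rw [h1, hr.eq, cs.length_simple]; omega)]
    exact (isUnit_T_simple L i).mul (ih hr)

/-- The coefficient of `h` on `T_w`. -/
noncomputable def coord (h : Hecke cs L) (w : W) : Ground Γ := (basis L).repr h w

/-- The bar involution: `∑ a_w T_w ↦ ∑ (bar a_w) T_{w⁻¹}⁻¹`. All `T_w` are units. -/
noncomputable def bar (h : Hecke cs L) : Hecke cs L :=
  ((basis L).repr h).sum fun w a => groundBar a • Ring.inverse (T L w⁻¹)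

/-- `c` is the Kazhdan--Lusztig element `C_w`: it is fixed by the bar involution
and lies in `T_w + ⊕_y A_{<0} T_y`. -/
def IsKazhdanLusztig (w : W) (c : Hecke cs L) : Prop :=
  bar L c = c ∧ ∀ y : W, IsNegative (coord L (c - T L w) y)

/-- The sub-`A`-algebra generated by the `T_s` with `s ∈ I`. -/
noncomputable def parabolic (I : Set B) : Subalgebra (Ground Γ) (Hecke cs L) :=
  Algebra.adjoin (Ground Γ) ((fun i => T L (cs.simple i)) '' I)

end Hecke

end Hecke

section TypeB

open Hecke

variable {n : ℕ} (hn : 1 ≤ n) {W : Type*} [Group W] (cs : CoxeterSystem (CoxeterMatrix.B n) W)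

/-- The index of the generator `t`, the end node of the double bond of the Dynkin diagram
of type `B_n`. The remaining indices are those of `s_1, …, s_{n-1}`. -/
def tIndex : Fin n := ⟨n - 1, by omega⟩

/-- `ℓ_t(w)`: the number of occurrences of `t` in a reduced expression of `w`. -/
noncomputable def lengthT (w : W) : ℕ := (redWord cs w).count (tIndex hn)

theorem signT_liftable : (CoxeterMatrix.B n).IsLiftable
    (fun i => Multiplicative.ofAdd (if i = tIndex hn then (1 : ZMod 2) else 0)) := by
  intro i j
  rw [← ofAdd_add, ← ofAdd_nsmul, ← ofAdd_zero]
  congr 1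
  rw [nsmul_eq_mul]
  by_cases hij : i = j
  · subst hij; simp [CharTwo.add_self_eq_zero]
  · have hM : (CoxeterMatrix.B n) i j =
        if i = j then 1
        else (if (i : ℕ) = n - 1 ∧ (j : ℕ) = n - 2 ∨ (j : ℕ) = n - 1 ∧ (i : ℕ) = n - 2 then 4
          else (if (j : ℕ) + 1 = i ∨ (i : ℕ) + 1 = j then 3 else 2)) := rfl
    rw [hM, if_neg hij]
    have h4 : (4 : ZMod 2) = 0 := rfl
    have h2 : (2 : ZMod 2) = 0 := rfl
    by_cases a : (i : ℕ) = n - 1 ∧ (j : ℕ) = n - 2 ∨ (j : ℕ) = n - 1 ∧ (i : ℕ) = n - 2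
    · rw [if_pos a, Nat.cast_ofNat, h4, zero_mul]
    · rw [if_neg a]
      by_cases b : (j : ℕ) + 1 = i ∨ (i : ℕ) + 1 = j
      · have hi : i ≠ tIndex hn := by
          simp only [tIndex, ne_eq, Fin.ext_iff] at *
          omega
        have hj : j ≠ tIndex hn := by
          simp only [tIndex, ne_eq, Fin.ext_iff] at *
          omega
        rw [if_neg hi, if_neg hj, add_zero, mul_zero]
      · rw [if_neg b, Nat.cast_ofNat, h2, zero_mul]

/-- The linear character of `W` (with values in `ℤ/2`) sending `t` to `1` and each `s_i` to `0`. -/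
noncomputable def signT : W →* Multiplicative (ZMod 2) :=
  cs.lift ⟨_, signT_liftable hn⟩

theorem signT_simple (i : Fin n) :
    signT hn cs (cs.simple i) = Multiplicative.ofAdd (if i = tIndex hn then 1 else 0) :=
  cs.lift_apply_simple _ i

theorem countP_rightInvSeq (ω : List (Fin n)) :
    (cs.rightInvSeq ω).countP (fun r => decide (signT hn cs r ≠ 1)) = ω.count (tIndex hn) := by
  induction ω with
  | nil => simp
  | cons i ω ih =>
    have h : signT hn cs ((cs.wordProd ω)⁻¹ * cs.simple i * cs.wordProd ω) ≠ 1 ↔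
        i = tIndex hn := by
      rw [map_mul, map_mul, map_inv, mul_comm, mul_inv_cancel_left, signT_simple]
      by_cases hi : i = tIndex hn <;> simp [hi]
    rw [CoxeterSystem.rightInvSeq, List.countP_cons, ih, List.count_cons]
    simp only [h, decide_eq_true_eq, beq_iff_eq]

/-- `ℓ_t(w)` can be computed from any reduced expression. -/
theorem lengthT_wordProd {ω : List (Fin n)} (h : cs.IsReduced ω) :
    lengthT hn cs (cs.wordProd ω) = ω.count (tIndex hn) := by
  rw [lengthT, ← countP_rightInvSeq hn cs ω, ← countP_rightInvSeq hn cs]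
  exact (rightInvSeq_perm cs (redWord_isReduced cs _) h (redWord_prod cs _)).countP_eq _

theorem lengthT_mul {w w' : W} (h : cs.length (w * w') = cs.length w + cs.length w') :
    lengthT hn cs (w * w') = lengthT hn cs w + lengthT hn cs w' := by
  obtain ⟨ω, hω, rfl⟩ := cs.exists_isReduced w
  obtain ⟨ω', hω', rfl⟩ := cs.exists_isReduced w'
  have hr : cs.IsReduced (ω ++ ω') := by
    rw [CoxeterSystem.IsReduced, cs.wordProd_append, h, hω.eq, hω'.eq, List.length_append]
  rw [← cs.wordProd_append, lengthT_wordProd hn cs hr, lengthT_wordProd hn cs hω,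
    lengthT_wordProd hn cs hω', List.count_append]

theorem lengthT_simple (i : Fin n) :
    lengthT hn cs (cs.simple i) = if i = tIndex hn then 1 else 0 := by
  have hr : cs.IsReduced [i] := by simp [CoxeterSystem.IsReduced]
  have := lengthT_wordProd hn cs hr
  rw [cs.wordProd_singleton] at this
  rw [this]
  simp [List.count_cons]

/-- The weight function `L_n(w) = (ℓ_t(w), ℓ_s(w))`, where `ℓ_s = ℓ - ℓ_t`, with values in `ℤ²`
ordered lexicographically. -/
noncomputable def weightB : WeightFunction cs (ℤ ×ₗ ℤ) where
  toFun w := toLex ((lengthT hn cs w : ℤ), (cs.length w : ℤ) - (lengthT hn cs w : ℤ))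
  map_mul' w w' h := by
    rw [← toLex_add, lengthT_mul hn cs h, h]
    congr 1
    ext
    · simp
    · simp; ring
  pos' i := by
    rw [lengthT_simple, cs.length_simple]
    split_ifs <;> decide

/-- The Hecke algebra `H_n = H(W_n, S_n, L_n)`. -/
abbrev HeckeB : Type _ := Hecke cs (weightB hn cs)

/-- The element `V = v^(1,0)` of the ground ring. -/
noncomputable def V : Ground (ℤ ×ₗ ℤ) := vpow (toLex ((1 : ℤ), (0 : ℤ)))

/-- The standard basis element `T_t`. -/
noncomputable def Tt : HeckeB hn cs := T (weightB hn cs) (cs.simple (tIndex hn))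

/-- `C_l`, the `A`-span of the Kazhdan--Lusztig elements `C_w` with `ℓ_t(w) = l`. -/
noncomputable def spanC (l : ℕ) : Submodule (Ground (ℤ ×ₗ ℤ)) (HeckeB hn cs) :=
  Submodule.span (Ground (ℤ ×ₗ ℤ))
    {c | ∃ w : W, lengthT hn cs w = l ∧ IsKazhdanLusztig (weightB hn cs) w c}

/-- `H(𝔖_n)`, the subalgebra generated by `T_{s_1}, …, T_{s_{n-1}}`. -/
noncomputable def heckeSym : Subalgebra (Ground (ℤ ×ₗ ℤ)) (HeckeB hn cs) :=
  parabolic (weightB hn cs) {i | i ≠ tIndex hn}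

end TypeB

end CoxeterHecke

/-! Let N be the set of h satisfying condition 3 (`symAnnihilator`). It is stable under T_s for s in
the symmetric group by definition, and T_t acts on it as the scalar V, so N is a left ideal of the
whole algebra. This gives the equivalence of 2 and 3. Since T_t⁻¹ acts as V⁻¹, N is also stable
under the bar involution (`bar_mem_symAnnihilator`). It remains to show that N is the span of the
C_w with ℓ_t(w) = n.

Upper bound on N. If tw > w, the coefficient of T_w in T_t h = V h shows that the coefficient of h
at w is V⁻¹ times the one at tw. If ℓ_t(w) < n, some element of 𝔖_n w is lengthened by t, and the
T_s carry the information back to w. Hence h is determined by its coefficients on the T_w with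
ℓ_t(w) = n, and each missing t costs a factor V⁻¹, up to coefficients of degree 0 in V
(`coord_mem_of_mem_symAnnihilator`). In the lexicographic order negative V-degree already means
negative.

Lower bound on N. With L_0 = T_t and L_i = T_{s_i} L_{i-1} T_{s_i}, the product of the L_i + V⁻¹ for
i < n commutes with H(𝔖_n) and is killed by T_t - V, because (T_t - V)(T_t + V⁻¹) = 0. Its leading
term is T_σ, where σ is the product of all sign changes and ℓ_t(σ) = n. The elements with ℓ_t = n
form the coset 𝔖_n σ, so multiplying by T_s and T_s⁻¹ produces, for each of them, an element of N
congruent to T_w modulo the T_y with ℓ_t(y) < n (`exists_mem_symAnnihilator`).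

The usual Kazhdan–Lusztig construction can therefore be run inside N, looking only at coefficients
with ℓ_t = n; the remaining ones are negative automatically. By uniqueness it yields C_w
(`exists_isKazhdanLusztig`), and triangularity in the length shows that these C_w span N
(`symAnnihilator_eq_spanC`). -/

namespace CoxeterHecke

/-! ### The ground ring: bar, negative exponents, degree in V. -/

section GroundLemmas

variable {Γ : Type*} [AddCommGroup Γ]

theorem vpow_zero : vpow (0 : Γ) = 1 := rfl

theorem vpow_add (γ δ : Γ) : vpow (γ + δ) = vpow γ * vpow δ := by
  rw [vpow, vpow, vpow, AddMonoidAlgebra.single_mul_single, one_mul]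

theorem vpow_neg_mul_vpow (γ : Γ) : vpow (-γ) * vpow γ = 1 := by
  rw [← vpow_add, neg_add_cancel, vpow_zero]

theorem coeff_vpow_mul (γ δ : Γ) (a : Ground Γ) :
    (vpow γ * a).coeff δ = a.coeff (-γ + δ) := by
  rw [vpow, AddMonoidAlgebra.coeff_single_mul_apply, one_mul]

theorem coeff_groundBar (a : Ground Γ) (γ : Γ) :
    (groundBar a).coeff γ = a.coeff (-γ) := by
  induction a using AddMonoidAlgebra.induction_linear with
  | zero => simp
  | add f g hf hg => simp [hf, hg]
  | single δ r =>
    classical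
    simp [groundBar, Finsupp.single_apply, neg_eq_iff_eq_neg]

theorem groundBar_groundBar (a : Ground Γ) : groundBar (groundBar a) = a := by
  ext γ; simp [coeff_groundBar]

theorem groundBar_vpow (γ : Γ) : groundBar (vpow γ) = vpow (-γ) := by
  ext δ
  classical
  simp [coeff_groundBar, vpow, Finsupp.single_apply, neg_eq_iff_eq_neg]

variable [LinearOrder Γ]

theorem isNegative_zero : IsNegative (0 : Ground Γ) := fun _ h => absurd rfl h

theorem IsNegative.sub {a b : Ground Γ} (ha : IsNegative a) (hb : IsNegative b) :
    IsNegative (a - b) := by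
  intro γ h
  by_contra hγ
  have h1 : a.coeff γ = 0 := by by_contra h'; exact hγ (ha γ h')
  have h2 : b.coeff γ = 0 := by by_contra h'; exact hγ (hb γ h')
  apply h
  rw [AddMonoidAlgebra.coeff_sub, Finsupp.sub_apply, h1, h2, sub_zero]

theorem IsNegative.eq_zero [IsOrderedAddMonoid Γ] {a : Ground Γ} (ha : IsNegative a)
    (h : groundBar a = a) : a = 0 := by
  ext γ
  by_contra h0
  have h1 := ha γ h0
  have h2 := ha (-γ) (by rw [← coeff_groundBar, h]; exact h0)
  rw [neg_lt_zero] at h2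
  exact lt_asymm h1 h2

/-- The part of `a` with negative exponents. -/
noncomputable def negativePart (a : Ground Γ) : Ground Γ :=
  AddMonoidAlgebra.ofCoeff (a.coeff.filter (· < 0))

theorem coeff_negativePart (a : Ground Γ) (γ : Γ) :
    (negativePart a).coeff γ = if γ < 0 then a.coeff γ else 0 := by
  rw [negativePart, AddMonoidAlgebra.coeff_ofCoeff, Finsupp.filter_apply]

theorem isNegative_negativePart (a : Ground Γ) : IsNegative (negativePart a) := by
  intro γ h
  rw [coeff_negativePart] at h
  by_contra h'
  exact h (if_neg h')

theorem negativePart_zero : negativePart (0 : Ground Γ) = 0 := by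
  ext γ; simp [coeff_negativePart]

/-- Anti-invariance pairs the coefficients at γ and -γ with opposite signs. The constant coefficient
equals its own negative, hence is 0 in ℤ. -/
theorem negativePart_sub_bar [IsOrderedAddMonoid Γ] {a : Ground Γ} (h : groundBar a = -a) :
    negativePart a - groundBar (negativePart a) = a := by
  ext γ
  have hγ : a.coeff (-γ) = - a.coeff γ := by
    rw [← coeff_groundBar, h]; rfl
  rw [AddMonoidAlgebra.coeff_sub, Finsupp.sub_apply, coeff_groundBar, coeff_negativePart,
    coeff_negativePart, hγ]
  rcases lt_trichotomy γ 0 with h1 | h1 | h1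
  · rw [if_pos h1, if_neg (by rw [neg_lt_zero]; exact h1.le.not_gt), sub_zero]
  · subst h1
    rw [neg_zero] at hγ
    simp; omega
  · rw [if_neg h1.le.not_gt, if_pos (by rwa [neg_lt_zero])]; simp

end GroundLemmas

/-- The elements of `ℤ[ℤ²]` of degree at most `d` in `V`. -/
def vDegLE (d : ℤ) : AddSubgroup (Ground (ℤ ×ₗ ℤ)) where
  carrier := {a | ∀ γ, a.coeff γ ≠ 0 → (ofLex γ).1 ≤ d}
  zero_mem' := fun _ h => absurd rfl h
  add_mem' := by
    intro a b ha hb γ h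
    by_contra hγ
    have h1 : a.coeff γ = 0 := by by_contra h'; exact hγ (ha γ h')
    have h2 : b.coeff γ = 0 := by by_contra h'; exact hγ (hb γ h')
    apply h
    rw [AddMonoidAlgebra.coeff_add, Finsupp.add_apply, h1, h2, add_zero]
  neg_mem' := by
    intro a ha γ h
    apply ha γ
    intro h'
    apply h
    rw [AddMonoidAlgebra.coeff_neg, Finsupp.neg_apply, h', neg_zero]

theorem vpow_mul_mem_vDegLE {d e : ℤ} {a : Ground (ℤ ×ₗ ℤ)} (ha : a ∈ vDegLE d)
    (γ : ℤ ×ₗ ℤ) (h : (ofLex γ).1 + d ≤ e) : vpow γ * a ∈ vDegLE e := by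
  intro δ hδ
  rw [coeff_vpow_mul] at hδ
  have := ha _ hδ
  simp at this
  omega

theorem one_mem_vDegLE : (1 : Ground (ℤ ×ₗ ℤ)) ∈ vDegLE 0 := by
  intro γ h
  rw [← vpow_zero, vpow, AddMonoidAlgebra.coeff_single, Finsupp.single_apply] at h
  have : γ = 0 := by
    by_contra h'
    exact h (if_neg (Ne.symm h'))
  rw [this]; rfl

theorem IsNegative.mem_vDegLE {a : Ground (ℤ ×ₗ ℤ)} (ha : IsNegative a) : a ∈ vDegLE 0 := by
  intro γ h
  have := Prod.Lex.lt_iff.mp (ha γ h)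
  simp at this
  omega

/-- The lexicographic order is essential here: the degree in V outweighs any power of v. -/
theorem isNegative_of_mem_vDegLE {a : Ground (ℤ ×ₗ ℤ)} {d : ℤ} (ha : a ∈ vDegLE d) (hd : d < 0) :
    IsNegative a := by
  intro γ h
  exact Prod.Lex.lt_iff.mpr (Or.inl (lt_of_le_of_lt (ha γ h) hd))

/-! ### Right inversions of group elements and their cocycle. -/

section Reflections

variable {B W : Type*} [Group W] {M : CoxeterMatrix B} (cs : CoxeterSystem M W)

/-- The parity of the number of occurrences of `r` among the right inversions of a word of `w`. -/
noncomputable def invParity (w r : W) : ZMod 2 :=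
  (cs.lift ⟨reflFlip cs, reflFlip_liftable cs⟩ w (r, 0)).2

open Classical in
theorem invParity_wordProd (ω : List B) (r : W) :
    invParity cs (cs.wordProd ω) r = ((cs.rightInvSeq ω).count r : ℕ) := by
  rw [invParity, lift_reflFlip_wordProd, zero_add]

/-- The cocycle rule comes from multiplicativity of the action of W on W × ℤ/2. It allows inversions
to be compared without choosing reduced words. -/
theorem invParity_mul (x y r : W) :
    invParity cs (x * y) r = invParity cs y r + invParity cs x (y * r * y⁻¹) := by
  obtain ⟨ω, rfl⟩ := cs.wordProd_surjective x
  obtain ⟨ω', rfl⟩ := cs.wordProd_surjective y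
  classical
  rw [invParity, map_mul, Equiv.Perm.mul_apply, lift_reflFlip_wordProd, lift_reflFlip_wordProd,
    invParity_wordProd, invParity_wordProd, zero_add]

open Classical in
theorem invParity_eq_ite {ω : List B} (h : cs.IsReduced ω) (r : W) :
    invParity cs (cs.wordProd ω) r = if r ∈ cs.rightInvSeq ω then 1 else 0 := by
  rw [invParity_wordProd]
  have h1 := List.nodup_iff_count_le_one.mp (h.nodup_rightInvSeq cs) r
  split_ifs with hr
  · have := List.count_pos_iff.mpr hr
    rw [show List.count r (cs.rightInvSeq ω) = 1 by omega, Nat.cast_one]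
  · rw [List.count_eq_zero_of_not_mem hr, Nat.cast_zero]

/-- A word whose right inversions are distinct is reduced. -/
theorem isReduced_of_nodup {ω : List B} (h : (cs.rightInvSeq ω).Nodup) : cs.IsReduced ω := by
  classical
  obtain ⟨ω', h', hw⟩ := cs.exists_isReduced (cs.wordProd ω)
  have hsub : cs.rightInvSeq ω ⊆ cs.rightInvSeq ω' := by
    intro r hr
    have h1 := invParity_eq_ite cs h' r
    rw [← hw, invParity_wordProd, List.count_eq_one_of_mem h hr] at h1
    by_contra h2
    rw [if_neg h2] at h1
    exact absurd h1 (by decide)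
  -- Parities depend only on the group element, so each of the distinct inversions of `ω` occurs in
  -- the reduced word `ω'`; hence `ω` is no longer than `ω'`.
  have h3 := (List.subperm_of_subset h hsub).length_le
  rw [cs.length_rightInvSeq, cs.length_rightInvSeq, ← h'.eq, ← hw] at h3
  exact le_antisymm (cs.length_wordProd_le ω) h3

/-- `s` is a right descent of `w` iff it is a right inversion of `w`. -/
theorem length_mul_simple_lt_iff (w : W) (i : B) :
    cs.length (w * cs.simple i) < cs.length w ↔ invParity cs w (cs.simple i) = 1 := by
  classical
  have key : ∀ w : W, cs.length (w * cs.simple i) < cs.length w →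
      invParity cs w (cs.simple i) = 1 := by
    intro w h
    have h1 : cs.length (w * cs.simple i) + 1 = cs.length w := by
      rcases cs.length_mul_simple w i with h | h <;> omega
    obtain ⟨ω, hω, hw⟩ := cs.exists_isReduced (w * cs.simple i)
    have p : cs.wordProd (ω.concat i) = w := by
      rw [cs.wordProd_concat, ← hw]; simp
    have r : cs.IsReduced (ω.concat i) := by
      rw [CoxeterSystem.IsReduced, p, ← h1, hw, hω.eq]; simp
    rw [← p, invParity_eq_ite cs r, if_pos]
    rw [cs.rightInvSeq_concat]; simp
  refine ⟨key w, fun h => ?_⟩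
  by_contra h'
  -- If s is not a descent of w, it is one of ws; the cocycle then makes the parity at w equal to 0.
  have h1 := key (w * cs.simple i) (by
    rw [cs.simple_mul_simple_cancel_right]
    rcases cs.length_mul_simple w i with h | h <;> omega)
  have h2 : invParity cs (cs.simple i) (cs.simple i) = 1 := by
    apply key; simp
  rw [invParity_mul, h2, mul_assoc, mul_inv_cancel, mul_one, h] at h1
  exact absurd h1 (by decide)

end Reflections

/-! ### Commutation of Jucys–Murphy products from the braid relations alone. -/

section Braids

/-- The Jucys--Murphy type products `L_0 = g_0`, `L_{i+1} = g_{i+1} L_i g_{i+1}`. -/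
def jucysMurphy {G : Type*} [Monoid G] (g : ℕ → G) : ℕ → G
  | 0 => g 0
  | i + 1 => g (i + 1) * jucysMurphy g i * g (i + 1)

/-- The braid relations of type `B_n` for elements `g_0, …, g_{n-1}`, with the double bond
between `g_0` and `g_1`. -/
structure IsBraidB {G : Type*} [Monoid G] (n : ℕ) (g : ℕ → G) : Prop where
  four : 1 < n → g 0 * g 1 * g 0 * g 1 = g 1 * g 0 * g 1 * g 0
  three : ∀ i, 1 ≤ i → i + 1 < n → g i * g (i + 1) * g i = g (i + 1) * g i * g (i + 1)
  comm : ∀ i j, i + 1 < j → j < n → Commute (g i) (g j)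

variable {G : Type*} [Monoid G] {n : ℕ} {g : ℕ → G}

theorem IsBraidB.commute_of_lt (h : IsBraidB n g) {i j : ℕ} (hij : i + 1 < j) (hj : j < n) :
    Commute (g j) (jucysMurphy g i) := by
  induction i with
  | zero => exact (h.comm 0 j hij hj).symm
  | succ i ih =>
    have := (h.comm (i + 1) j hij hj).symm
    exact (this.mul_right (ih (by omega))).mul_right this

/-- The only case that is not formal is g_j against L_{j+1}. There the braid relation turns g_j into
g_{j+1}, which passes through L_{j-1}, and a second braid relation turns it back into g_j. For j = 0
this is the relation of length four. No inverses are used, so the result holds in the Hecke algebra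
as well as in groups. -/
theorem IsBraidB.commute_of_gt (h : IsBraidB n g) {i j : ℕ} (hij : j < i) (hi : i < n) :
    Commute (g j) (jucysMurphy g i) := by
  induction i with
  | zero => omega
  | succ i ih =>
    rcases Nat.lt_succ_iff_lt_or_eq.mp hij with h1 | rfl
    · have := h.comm j (i + 1) (by omega) hi
      exact (this.mul_right (ih h1 (by omega))).mul_right this
    · cases j with
      | zero =>
        have := h.four hi
        simp only [jucysMurphy, Commute, SemiconjBy, zero_add, mul_assoc] at this ⊢
        exact this
      | succ j =>
        have hb := h.three (j + 1) (by omega) hi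
        have hc := h.commute_of_lt (i := j) (j := j + 2) (by omega) hi
        simp only [jucysMurphy, Commute, SemiconjBy] at hb hc ⊢
        calc g (j + 1) * (g (j + 2) * (g (j + 1) * jucysMurphy g j * g (j + 1)) * g (j + 2))
            = (g (j + 1) * g (j + 2) * g (j + 1)) * jucysMurphy g j * g (j + 1) * g (j + 2) := by
              simp only [mul_assoc]
          _ = g (j + 2) * g (j + 1) * (g (j + 2) * jucysMurphy g j) * g (j + 1) * g (j + 2) := by
              rw [hb]; simp only [mul_assoc]
          _ = g (j + 2) * g (j + 1) * jucysMurphy g j * (g (j + 2) * g (j + 1) * g (j + 2)) := by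
              rw [hc]; simp only [mul_assoc]
          _ = g (j + 2) * (g (j + 1) * jucysMurphy g j * g (j + 1)) * g (j + 2) * g (j + 1) := by
              rw [← hb]; simp only [mul_assoc]

theorem IsBraidB.jucysMurphy_commute_of_lt (h : IsBraidB n g) {i j : ℕ} (hij : i < j) (hj : j < n) :
    Commute (jucysMurphy g i) (jucysMurphy g j) := by
  induction i with
  | zero => exact h.commute_of_gt hij hj
  | succ i ih =>
    have := h.commute_of_gt hij hj
    exact (this.mul_left (ih (by omega))).mul_left this

end Braids

/-! ### Signed permutations as a model for the Coxeter group. -/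

section Model

theorem coxeterMatrixB_apply {n : ℕ} (i j : Fin n) : (CoxeterMatrix.B n) i j =
    if i = j then 1
    else (if (i : ℕ) = n - 1 ∧ (j : ℕ) = n - 2 ∨ (j : ℕ) = n - 1 ∧ (i : ℕ) = n - 2 then 4
      else (if (j : ℕ) + 1 = i ∨ (i : ℕ) + 1 = j then 3 else 2)) := rfl

/-- The elements g_j are numbered by distance from t, whereas t is the last index of
`CoxeterMatrix.B n`; this accounts for the reversal `n - 1 - i`. For involutions a braid relation of
length m is the same as (ab)^m = 1. -/
theorem IsBraidB.isLiftable {G : Type*} [Group G] {n : ℕ} {g : ℕ → G} (h : IsBraidB n g)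
    (hg : ∀ j, g j * g j = 1) :
    (CoxeterMatrix.B n).IsLiftable (fun i : Fin n => g (n - 1 - i)) := by
  have p2 : ∀ a b : G, a * a = 1 → b * b = 1 → a * b = b * a → (a * b) ^ 2 = 1 := by
    intro a b ha hb hab
    rw [pow_two]; nth_rewrite 2 [hab]
    rw [mul_assoc, ← mul_assoc b, hb, one_mul, ha]
  have p3 : ∀ a b : G, a * a = 1 → b * b = 1 → a * b * a = b * a * b → (a * b) ^ 3 = 1 := by
    intro a b ha hb hab
    calc (a * b) ^ 3 = (a * b * a) * (b * a * b) := by simp only [pow_succ, pow_zero, one_mul, mul_assoc]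
      _ = b * a * (b * b) * a * b := by rw [hab]; simp only [mul_assoc]
      _ = 1 := by rw [hb, mul_one, mul_assoc b, ha, mul_one, hb]
  have p4 : ∀ a b : G, a * a = 1 → b * b = 1 → a * b * a * b = b * a * b * a →
      (a * b) ^ 4 = 1 := by
    intro a b ha hb hab
    calc (a * b) ^ 4 = (a * b * a * b) * (a * b * a * b) := by
          simp only [pow_succ, pow_zero, one_mul, mul_assoc]
      _ = b * a * b * (a * a) * b * a * b := by
          nth_rewrite 1 [hab]; simp only [mul_assoc]
      _ = b * a * (b * b) * a * b := by rw [ha]; simp only [mul_assoc, one_mul]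
      _ = 1 := by rw [hb, mul_one, mul_assoc b, ha, mul_one, hb]
  intro i j
  have hi := i.isLt
  have hj := j.isLt
  rw [coxeterMatrixB_apply]
  split_ifs with h1 h2 h3
  · rw [h1, pow_one]; exact hg _
  · rcases h2 with ⟨h2, h3⟩ | ⟨h2, h3⟩
    · have e1 : n - 1 - (i : ℕ) = 0 := by omega
      have e2 : n - 1 - (j : ℕ) = 1 := by
        have : (i : ℕ) ≠ j := fun h => h1 (Fin.ext h)
        omega
      dsimp only
      rw [e1, e2]
      exact p4 _ _ (hg _) (hg _) (h.four (by omega))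
    · have e1 : n - 1 - (j : ℕ) = 0 := by omega
      have e2 : n - 1 - (i : ℕ) = 1 := by
        have : (i : ℕ) ≠ j := fun h => h1 (Fin.ext h)
        omega
      dsimp only
      rw [e1, e2]
      exact p4 _ _ (hg _) (hg _) (h.four (by omega)).symm
  · rcases h3 with h3 | h3
    · have e : n - 1 - (j : ℕ) = n - 1 - (i : ℕ) + 1 := by omega
      dsimp only
      rw [e]
      exact p3 _ _ (hg _) (hg _) (h.three _ (by omega) (by omega))
    · have e : n - 1 - (i : ℕ) = n - 1 - (j : ℕ) + 1 := by omega
      dsimp only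
      rw [e]
      exact p3 _ _ (hg _) (hg _) (h.three _ (by omega) (by omega)).symm
  · have hne : (i : ℕ) ≠ j := fun h => h1 (Fin.ext h)
    apply p2 _ _ (hg _) (hg _)
    rcases Nat.lt_or_gt_of_ne hne with hlt | hlt
    · exact (h.comm (n - 1 - j) (n - 1 - i) (by omega) (by omega)).symm
    · exact h.comm (n - 1 - i) (n - 1 - j) (by omega) (by omega)

/-- The generators of the group of signed permutations, acting on `ℕ × {±}`. -/
def signedGen : ℕ → Equiv.Perm (ℕ × ZMod 2)
  | 0 => Equiv.swap (0, 0) (0, 1)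
  | j + 1 => Equiv.prodCongr (Equiv.swap j (j + 1)) (Equiv.refl _)

theorem signedGen_zero_apply (p : ℕ × ZMod 2) :
    signedGen 0 p = if p.1 = 0 then (0, p.2 + 1) else p := by
  obtain ⟨c, b⟩ := p
  rcases c with _ | c
  · revert b; decide
  · simp [signedGen, Equiv.swap_apply_def]

theorem signedGen_succ_apply (j : ℕ) (p : ℕ × ZMod 2) :
    signedGen (j + 1) p = (if p.1 = j then j + 1 else if p.1 = j + 1 then j else p.1, p.2) := by
  obtain ⟨c, b⟩ := p
  simp [signedGen, Equiv.swap_apply_def]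

theorem signedGen_mul_self (j : ℕ) : signedGen j * signedGen j = 1 := by
  cases j with
  | zero => simp [signedGen]
  | succ j =>
    ext1 ⟨c, b⟩
    simp [signedGen]

theorem signedGen_isBraidB (n : ℕ) : IsBraidB n signedGen where
  four _ := by
    ext1 ⟨c, b⟩
    have h1 := signedGen_succ_apply 0
    simp only [zero_add] at h1
    simp only [Equiv.Perm.mul_apply, signedGen_zero_apply, h1]
    rcases c with _ | _ | c <;> simp
  three i h1 _ := by
    obtain ⟨i, rfl⟩ := Nat.exists_eq_add_of_le' h1
    ext1 ⟨c, b⟩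
    simp only [Equiv.Perm.mul_apply, signedGen_succ_apply, Prod.mk.injEq, and_true]
    grind
  comm i j h1 _ := by
    obtain ⟨j, rfl⟩ : ∃ k, j = k + 1 := ⟨j - 1, by omega⟩
    ext1 ⟨c, b⟩
    cases i with
    | zero =>
      simp only [Equiv.Perm.mul_apply, signedGen_zero_apply, signedGen_succ_apply]
      grind
    | succ i =>
      simp only [Equiv.Perm.mul_apply, signedGen_succ_apply, Prod.mk.injEq, and_true]
      grind

theorem signedGen_apply_of_lt {j m : ℕ} (h : j < m) (b : ZMod 2) :
    signedGen j (m, b) = (m, b) := by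
  cases j with
  | zero => rw [signedGen_zero_apply, if_neg (by dsimp only; omega)]
  | succ j =>
    rw [signedGen_succ_apply]
    dsimp only
    rw [if_neg (by omega), if_neg (by omega)]

theorem jucysMurphy_signedGen_apply_of_lt {j m : ℕ} (h : j < m) (b : ZMod 2) :
    jucysMurphy signedGen j (m, b) = (m, b) := by
  induction j with
  | zero => exact signedGen_apply_of_lt h b
  | succ j ih =>
    rw [jucysMurphy, Equiv.Perm.mul_apply, Equiv.Perm.mul_apply, signedGen_apply_of_lt h,
      ih (by omega), signedGen_apply_of_lt h]

end Model

/-! ### Reduced words for products of sign changes. -/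

section TypeB

variable {n : ℕ} (hn : 1 ≤ n) {W : Type*} [Group W] (cs : CoxeterSystem (CoxeterMatrix.B n) W)

/-- The index of the generator at distance `j` from `t` in the Dynkin diagram. -/
def nodeIndex (j : ℕ) : Fin n := ⟨n - 1 - j, by omega⟩

theorem nodeIndex_zero : nodeIndex hn 0 = tIndex hn := rfl

theorem nodeIndex_ne_tIndex {j : ℕ} (h0 : 0 < j) (hj : j < n) :
    nodeIndex hn j ≠ tIndex hn := by
  simp only [nodeIndex, tIndex, ne_eq, Fin.mk.injEq]
  omega

theorem exists_eq_nodeIndex (i : Fin n) : ∃ j < n, i = nodeIndex hn j :=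
  ⟨n - 1 - i, by omega, Fin.ext (by simp only [nodeIndex]; omega)⟩

/-- The generator at distance `j` from `t` in the Dynkin diagram. -/
def node (j : ℕ) : W := cs.simple (nodeIndex hn j)

theorem node_mul_self (j : ℕ) : node hn cs j * node hn cs j = 1 := cs.simple_mul_simple_self _

theorem node_isBraidB : IsBraidB n (node hn cs) where
  four h := by
    have := cs.simple_mul_simple_pow (nodeIndex hn 0) (nodeIndex hn 1)
    rw [coxeterMatrixB_apply, if_neg (by simp [nodeIndex]; omega),
      if_pos (by simp only [nodeIndex]; omega)] at this
    apply eq_of_mul_inv_eq_one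
    rw [← this]
    simp only [node, mul_inv_rev, cs.inv_simple, pow_succ, pow_zero, one_mul, mul_assoc]
  three i h1 h2 := by
    have := cs.simple_mul_simple_pow (nodeIndex hn i) (nodeIndex hn (i + 1))
    rw [coxeterMatrixB_apply, if_neg (by simp [nodeIndex]; omega),
      if_neg (by simp only [nodeIndex]; omega), if_pos (by simp only [nodeIndex]; omega)] at this
    apply eq_of_mul_inv_eq_one
    rw [← this]
    simp only [node, mul_inv_rev, cs.inv_simple, pow_succ, pow_zero, one_mul, mul_assoc]
  comm i j h1 h2 := by
    have := cs.simple_mul_simple_pow (nodeIndex hn i) (nodeIndex hn j)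
    rw [coxeterMatrixB_apply, if_neg (by simp [nodeIndex]; omega),
      if_neg (by simp only [nodeIndex]; omega), if_neg (by simp only [nodeIndex]; omega)] at this
    apply eq_of_mul_inv_eq_one
    rw [← this]
    simp only [node, mul_inv_rev, cs.inv_simple, pow_succ, pow_zero, one_mul, mul_assoc]

/-- The action of `W` by signed permutations. -/
noncomputable def signedPerm : W →* Equiv.Perm (ℕ × ZMod 2) :=
  cs.lift ⟨_, (signedGen_isBraidB n).isLiftable signedGen_mul_self⟩

theorem signedPerm_node {j : ℕ} (hj : j < n) :
    signedPerm cs (node hn cs j) = signedGen j := by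
  rw [signedPerm, node, cs.lift_apply_simple]
  simp only [nodeIndex]
  congr 1
  omega

/-- The palindromic word of the reflection obtained from `t` by conjugation with the first
`m` generators of the symmetric group. -/
def palindrome : ℕ → List (Fin n)
  | 0 => [tIndex hn]
  | m + 1 => nodeIndex hn (m + 1) :: (palindrome m).concat (nodeIndex hn (m + 1))

theorem wordProd_palindrome (m : ℕ) :
    cs.wordProd (palindrome hn m) = jucysMurphy (node hn cs) m := by
  induction m with
  | zero => rw [palindrome, cs.wordProd_singleton]; rfl
  | succ m ih =>
    rw [palindrome, cs.wordProd_cons, cs.wordProd_concat, ih, jucysMurphy, mul_assoc]; rfl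

theorem signedPerm_jucysMurphy {m : ℕ} (hm : m < n) :
    signedPerm cs (jucysMurphy (node hn cs) m) = jucysMurphy signedGen m := by
  induction m with
  | zero => exact signedPerm_node hn cs hm
  | succ m ih =>
    rw [jucysMurphy, jucysMurphy, map_mul, map_mul, ih (by omega), signedPerm_node hn cs hm]

/-- The right inversions are told apart by the image of the single point (m, 0). In the inductive
step, conjugation by g_{m+1} keeps the old images distinct and moves them off the column m, while
the two new letters send (m + 1, 0) to (m, 1) and (m, 0). -/
theorem nodup_map_rightInvSeq_palindrome {m : ℕ} (hm : m < n) :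
    ((cs.rightInvSeq (palindrome hn m)).map fun r => signedPerm cs r (m, 0)).Nodup ∧
    ∀ r ∈ cs.rightInvSeq (palindrome hn m), signedPerm cs r (m, 0) ≠ (m, 0) ∧
      (signedPerm cs r (m, 0)).1 ≤ m := by
  induction m with
  | zero =>
    have h0 : signedPerm cs (cs.simple (tIndex hn)) = signedGen 0 := signedPerm_node hn cs hm
    simp [palindrome, h0, signedGen_zero_apply]
  | succ m ih =>
    obtain ⟨h1, h2⟩ := ih (by omega)
    have hs : signedPerm cs (cs.simple (nodeIndex hn (m + 1))) = signedGen (m + 1) :=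
      signedPerm_node hn cs hm
    have hτ := signedPerm_jucysMurphy hn cs (m := m) (by omega)
    have hτi : (jucysMurphy signedGen m)⁻¹ (m + 1, 1) = (m + 1, 1) := by
      rw [Equiv.Perm.inv_eq_iff_eq, jucysMurphy_signedGen_apply_of_lt (by omega)]
    have hflip : ∀ m : ℕ, jucysMurphy signedGen m (m, 0) = (m, 1) := by
      intro m
      induction m with
      | zero => rw [jucysMurphy, signedGen_zero_apply]; rfl
      | succ m ih =>
        rw [jucysMurphy, Equiv.Perm.mul_apply, Equiv.Perm.mul_apply, signedGen_succ_apply]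
        simp [ih, signedGen_succ_apply]
    have e0 : signedGen (m + 1) (m, 0) = (m + 1, 0) := by simp [signedGen_succ_apply]
    have e1 : signedGen (m + 1) (m + 1, 0) = (m, 0) := by simp [signedGen_succ_apply]
    have e2 : signedGen (m + 1) (m, 1) = (m + 1, 1) := by simp [signedGen_succ_apply]
    have e3 : signedGen (m + 1) (m + 1, 1) = (m, 1) := by simp [signedGen_succ_apply]
    -- This reflection is s L_m⁻¹ s L_m s with s = g_{m+1}; the point travels (m+1,0), (m,0), (m,1),
    -- (m+1,1), (m+1,1), (m,1).
    have first : signedPerm cs ((cs.wordProd ((palindrome hn m).concat (nodeIndex hn (m + 1))))⁻¹ *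
        cs.simple (nodeIndex hn (m + 1)) *
        cs.wordProd ((palindrome hn m).concat (nodeIndex hn (m + 1)))) (m + 1, 0) = (m, 1) := by
      rw [cs.wordProd_concat, wordProd_palindrome, mul_inv_rev, cs.inv_simple]
      simp only [map_mul, map_inv, hs, hτ, Equiv.Perm.mul_apply, e1, hflip, e2, hτi, e3]
    have mid : ∀ r ∈ cs.rightInvSeq (palindrome hn m),
        signedPerm cs (MulAut.conj (cs.simple (nodeIndex hn (m + 1))) r) (m + 1, 0) =
          signedGen (m + 1) (signedPerm cs r (m, 0)) := by
      intro r _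
      rw [MulAut.conj_apply, cs.inv_simple]
      simp only [map_mul, hs, Equiv.Perm.mul_apply, e1]
    have mid2 : ∀ r ∈ cs.rightInvSeq (palindrome hn m),
        (signedGen (m + 1) (signedPerm cs r (m, 0))).1 ≤ m + 1 ∧
        (signedGen (m + 1) (signedPerm cs r (m, 0))).1 ≠ m ∧
        signedGen (m + 1) (signedPerm cs r (m, 0)) ≠ (m + 1, 0) := by
      intro r hr
      obtain ⟨h3, h4⟩ := h2 r hr
      refine ⟨?_, ?_, ?_⟩
      · rw [signedGen_succ_apply]; dsimp only; split_ifs <;> omega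
      · rw [signedGen_succ_apply]; dsimp only; split_ifs <;> omega
      · rw [← e0]
        exact (signedGen (m + 1)).injective.ne h3
    rw [palindrome, CoxeterSystem.rightInvSeq, cs.rightInvSeq_concat]
    constructor
    · rw [List.map_cons, first, List.concat_eq_append, List.map_append, List.map_map, List.nodup_cons,
        List.map_singleton, hs, e1]
      constructor
      · rw [List.mem_append, List.mem_map, List.mem_singleton]
        rintro (⟨r, hr, h⟩ | h)
        · rw [Function.comp_apply, mid r hr] at h
          exact (mid2 r hr).2.1 (by rw [h])
        · simp at h
      · rw [List.nodup_append]
        refine ⟨?_, List.nodup_singleton _, ?_⟩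
        · rw [List.map_congr_left (f := (fun r => signedPerm cs r (m + 1, 0)) ∘
              MulAut.conj (cs.simple (nodeIndex hn (m + 1)))) (g := fun r => signedGen (m + 1) (signedPerm cs r (m, 0)))
            (fun r hr => mid r hr)]
          have := h1.map (signedGen (m + 1)).injective
          rwa [List.map_map] at this
        · intro a ha b hb
          obtain ⟨r, hr, rfl⟩ := List.mem_map.mp ha
          rw [List.mem_singleton.mp hb, Function.comp_apply, mid r hr]
          intro h
          exact (mid2 r hr).2.1 (by rw [h])
    · intro r hr
      rcases List.mem_cons.mp hr with rfl | hr'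
      · rw [first]; simp
      rw [List.concat_eq_append, List.mem_append, List.mem_map, List.mem_singleton] at hr'
      rcases hr' with ⟨r', hr', rfl⟩ | rfl
      · rw [mid r' hr']
        exact ⟨(mid2 r' hr').2.2, (mid2 r' hr').1⟩
      · rw [hs, e1]; simp

theorem signedPerm_wordProd_apply {m : ℕ} {ω : List (Fin n)}
    (hω : ∀ i ∈ ω, ∃ j < m, j < n ∧ i = nodeIndex hn j) (b : ZMod 2) :
    signedPerm cs (cs.wordProd ω) (m, b) = (m, b) := by
  induction ω with
  | nil => simp
  | cons i ω ih =>
    obtain ⟨j, hj, hjn, rfl⟩ := hω i (by simp)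
    rw [cs.wordProd_cons, map_mul, Equiv.Perm.mul_apply,
      ih (fun i hi => hω i (List.mem_cons_of_mem _ hi))]
    have : signedPerm cs (cs.simple (nodeIndex hn j)) = signedGen j := signedPerm_node hn cs hjn
    rw [this, signedGen_apply_of_lt hj]

theorem rightInvSeq_append {B W : Type*} [Group W] {M : CoxeterMatrix B} (cs : CoxeterSystem M W)
    (ω ω' : List B) : cs.rightInvSeq (ω ++ ω') =
      (cs.rightInvSeq ω).map (fun r => (cs.wordProd ω')⁻¹ * r * cs.wordProd ω') ++
        cs.rightInvSeq ω' := by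
  induction ω with
  | nil => simp
  | cons i ω ih =>
    rw [List.cons_append, CoxeterSystem.rightInvSeq, ih, CoxeterSystem.rightInvSeq, cs.wordProd_append]
    simp [mul_assoc]

theorem signedPerm_rightInvSeq_apply {m : ℕ} {ω : List (Fin n)}
    (hω : ∀ i ∈ ω, ∃ j < m, j < n ∧ i = nodeIndex hn j) {r : W} (hr : r ∈ cs.rightInvSeq ω) :
    signedPerm cs r (m, 0) = (m, 0) := by
  induction ω with
  | nil => simp at hr
  | cons i ω ih =>
    have hω' : ∀ i ∈ ω, ∃ j < m, j < n ∧ i = nodeIndex hn j :=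
      fun i hi => hω i (List.mem_cons_of_mem _ hi)
    rw [CoxeterSystem.rightInvSeq, List.mem_cons] at hr
    rcases hr with rfl | hr
    · have h1 := signedPerm_wordProd_apply hn cs hω 0
      have h2 := signedPerm_wordProd_apply hn cs hω' 0
      rw [cs.wordProd_cons, map_mul, Equiv.Perm.mul_apply, h2] at h1
      rw [map_mul, map_mul, Equiv.Perm.mul_apply, Equiv.Perm.mul_apply, h2, h1, map_inv,
        Equiv.Perm.inv_eq_iff_eq, h2]
    · exact ih hω' hr

/-- The word `ω` uses only nodes below m, so it and all its right inversions fix (m, 0). The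
inversions contributed by the palindrome move that point to distinct places. All inversions are thus
distinct, and the word is reduced. -/
theorem isReduced_palindrome_append {m : ℕ} (hm : m < n) {ω : List (Fin n)} (hr : cs.IsReduced ω)
    (hω : ∀ i ∈ ω, ∃ j < m, j < n ∧ i = nodeIndex hn j) :
    cs.IsReduced (palindrome hn m ++ ω) := by
  obtain ⟨h1, h2⟩ := nodup_map_rightInvSeq_palindrome hn cs hm
  have hfix := signedPerm_wordProd_apply hn cs hω 0
  have hc : ∀ r : W, signedPerm cs ((cs.wordProd ω)⁻¹ * r * cs.wordProd ω) (m, 0) =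
      (signedPerm cs (cs.wordProd ω))⁻¹ (signedPerm cs r (m, 0)) := by
    intro r
    rw [map_mul, map_mul, Equiv.Perm.mul_apply, Equiv.Perm.mul_apply, hfix, map_inv]
  apply isReduced_of_nodup
  rw [rightInvSeq_append, List.nodup_append]
  refine ⟨?_, hr.nodup_rightInvSeq cs, ?_⟩
  · apply List.Nodup.of_map (fun r => signedPerm cs r (m, 0))
    rw [List.map_map]
    have := h1.map (signedPerm cs (cs.wordProd ω))⁻¹.injective
    rw [List.map_map] at this
    convert this using 2
    exact funext hc
  · intro a ha b hb hab
    subst hab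
    obtain ⟨r, hr', rfl⟩ := List.mem_map.mp ha
    have h3 := signedPerm_rightInvSeq_apply hn cs hω hb
    rw [hc, Equiv.Perm.inv_eq_iff_eq, hfix] at h3
    exact (h2 r hr').1 h3

theorem exists_of_mem_palindrome {m : ℕ} (hm : m < n) {i : Fin n} (hi : i ∈ palindrome hn m) :
    ∃ j < m + 1, j < n ∧ i = nodeIndex hn j := by
  induction m with
  | zero => exact ⟨0, by omega, by omega, List.mem_singleton.mp hi⟩
  | succ m ih =>
    rw [palindrome, List.mem_cons, List.concat_eq_append, List.mem_append, List.mem_singleton] at hi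
    rcases hi with rfl | hi | rfl
    · exact ⟨m + 1, by omega, by omega, rfl⟩
    · obtain ⟨j, h1, h2, h3⟩ := ih (by omega) hi
      exact ⟨j, by omega, h2, h3⟩
    · exact ⟨m + 1, by omega, by omega, rfl⟩

/-- A word for the product of the first `m` sign changes. -/
def signWord : ℕ → List (Fin n)
  | 0 => []
  | m + 1 => palindrome hn m ++ signWord m

theorem exists_of_mem_signWord {m : ℕ} (hm : m ≤ n) {i : Fin n} (hi : i ∈ signWord hn m) :
    ∃ j < m, j < n ∧ i = nodeIndex hn j := by
  induction m with
  | zero => simp [signWord] at hi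
  | succ m ih =>
    rw [signWord, List.mem_append] at hi
    rcases hi with hi | hi
    · exact exists_of_mem_palindrome hn hm hi
    · obtain ⟨j, h1, h2, h3⟩ := ih (by omega) hi
      exact ⟨j, by omega, h2, h3⟩

theorem isReduced_signWord {m : ℕ} (hm : m ≤ n) : cs.IsReduced (signWord hn m) := by
  induction m with
  | zero => simp [signWord, CoxeterSystem.IsReduced]
  | succ m ih =>
    exact isReduced_palindrome_append hn cs hm (ih (by omega))
      (fun i hi => exists_of_mem_signWord hn (by omega) hi)

theorem isReduced_of_infix {B W : Type*} [Group W] {M : CoxeterMatrix B} (cs : CoxeterSystem M W)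
    {ω ω' : List B} (h : cs.IsReduced ω') (hi : ω <:+: ω') : cs.IsReduced ω := by
  obtain ⟨a, b, rfl⟩ := hi
  have := (h.take (a ++ ω).length).drop a.length
  rwa [List.take_left, List.drop_left] at this

theorem isReduced_four (h : 1 < n) :
    cs.IsReduced [nodeIndex hn 1, nodeIndex hn 0, nodeIndex hn 1, nodeIndex hn 0] :=
  isReduced_signWord hn cs (m := 2) h

theorem isReduced_three {i : ℕ} (h1 : 1 ≤ i) (h2 : i + 1 < n) :
    cs.IsReduced [nodeIndex hn i, nodeIndex hn (i + 1), nodeIndex hn i] := by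
  obtain ⟨i, rfl⟩ := Nat.exists_eq_add_of_le' h1
  -- The factor straddles two blocks of the sign word: the palindrome of i + 2 ends in i + 1, i + 2
  -- and the next one begins with i + 1.
  apply isReduced_of_infix cs (isReduced_signWord hn cs (m := i + 3) h2)
  refine ⟨nodeIndex hn (i + 2) :: nodeIndex hn (i + 1) :: palindrome hn i,
    palindrome hn i ++ [nodeIndex hn (i + 1)] ++ signWord hn (i + 1), ?_⟩
  simp [signWord, palindrome]

theorem count_palindrome {m : ℕ} (hm : m < n) : (palindrome hn m).count (tIndex hn) = 1 := by
  induction m with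
  | zero => simp [palindrome]
  | succ m ih =>
    have := nodeIndex_ne_tIndex hn (j := m + 1) (by omega) hm
    rw [palindrome, List.count_cons_of_ne this, List.concat_eq_append, List.count_append,
      ih (by omega), List.count_singleton]
    simp [this]

theorem count_signWord {m : ℕ} (hm : m ≤ n) : (signWord hn m).count (tIndex hn) = m := by
  induction m with
  | zero => simp [signWord]
  | succ m ih =>
    rw [signWord, List.count_append, count_palindrome hn hm, ih (by omega), add_comm]

end TypeB

/-! ### The statistic ℓ_t as a count of inverted conjugates of t. -/

section TypeB

variable {n : ℕ} (hn : 1 ≤ n) {W : Type*} [Group W] (cs : CoxeterSystem (CoxeterMatrix.B n) W)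

theorem lengthT_simple_mul {i : Fin n} (hi : i ≠ tIndex hn) (w : W) :
    lengthT hn cs (cs.simple i * w) = lengthT hn cs w := by
  have key : ∀ w : W, cs.length (cs.simple i * w) = cs.length w + 1 →
      lengthT hn cs (cs.simple i * w) = lengthT hn cs w := by
    intro w h
    rw [lengthT_mul hn cs (by rw [h, cs.length_simple, add_comm]), lengthT_simple, if_neg hi, zero_add]
  rcases cs.length_simple_mul w i with h | h
  · exact key w h
  · have := key (cs.simple i * w) (by rw [cs.simple_mul_simple_cancel_left, h])
    rw [cs.simple_mul_simple_cancel_left] at this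
    exact this.symm

theorem lengthT_t_mul {w : W} (h : cs.length w < cs.length (cs.simple (tIndex hn) * w)) :
    lengthT hn cs (cs.simple (tIndex hn) * w) = lengthT hn cs w + 1 := by
  have h1 : cs.length (cs.simple (tIndex hn) * w) = cs.length w + 1 := by
    rcases cs.length_simple_mul w (tIndex hn) with h | h <;> omega
  rw [lengthT_mul hn cs (by rw [h1, cs.length_simple, add_comm]), lengthT_simple, if_pos rfl, add_comm]

theorem lengthT_inv (w : W) : lengthT hn cs w⁻¹ = lengthT hn cs w := by
  obtain ⟨ω, hω, rfl⟩ := cs.exists_isReduced w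
  rw [← cs.wordProd_reverse, lengthT_wordProd hn cs hω, lengthT_wordProd hn cs hω.reverse,
    List.count_reverse]

open Classical in
/-- The conjugates of `t`. -/
noncomputable def tReflections : Finset W :=
  (Finset.range n).image (jucysMurphy (node hn cs))

theorem mem_tReflections {r : W} :
    r ∈ tReflections hn cs ↔ ∃ m < n, jucysMurphy (node hn cs) m = r := by
  simp [tReflections]

theorem t_mem_tReflections : cs.simple (tIndex hn) ∈ tReflections hn cs :=
  (mem_tReflections hn cs).mpr ⟨0, hn, rfl⟩

/-- Conjugation by the generator j exchanges L_{j-1} and L_j and fixes the other products, by the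
braid commutations. -/
theorem simple_conj_mem_tReflections {r : W} (hr : r ∈ tReflections hn cs) (i : Fin n) :
    cs.simple i * r * cs.simple i ∈ tReflections hn cs := by
  rw [mem_tReflections] at hr ⊢
  obtain ⟨k, hk, rfl⟩ := hr
  obtain ⟨j, hj, rfl⟩ := exists_eq_nodeIndex hn i
  have hb := node_isBraidB hn cs
  change ∃ m < n, jucysMurphy (node hn cs) m =
    node hn cs j * jucysMurphy (node hn cs) k * node hn cs j
  have fix : Commute (node hn cs j) (jucysMurphy (node hn cs) k) →
      ∃ m < n, jucysMurphy (node hn cs) m =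
        node hn cs j * jucysMurphy (node hn cs) k * node hn cs j := by
    intro h
    exact ⟨k, hk, by rw [h.eq, mul_assoc, node_mul_self, mul_one]⟩
  rcases Nat.lt_trichotomy j k with h | rfl | h
  · exact fix (hb.commute_of_gt h hk)
  · cases j with
    | zero => exact fix (Commute.refl _)
    | succ j =>
      refine ⟨j, by omega, ?_⟩
      rw [jucysMurphy, mul_assoc, mul_assoc, mul_assoc, node_mul_self, mul_one, ← mul_assoc,
        node_mul_self, one_mul]
  · rcases Nat.lt_or_ge (k + 1) j with h' | h'
    · exact fix (hb.commute_of_lt h' hj)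
    · obtain rfl : j = k + 1 := by omega
      exact ⟨k + 1, hj, rfl⟩

theorem conj_mem_tReflections {r : W} (hr : r ∈ tReflections hn cs) (x : W) :
    x * r * x⁻¹ ∈ tReflections hn cs := by
  obtain ⟨ω, rfl⟩ := cs.wordProd_surjective x
  induction ω with
  | nil => simpa
  | cons i ω ih =>
    have := simple_conj_mem_tReflections hn cs ih i
    simpa [cs.wordProd_cons, mul_assoc] using this

theorem mem_tReflections_of_mem_rightInvSeq {ω : List (Fin n)} {r : W}
    (hr : r ∈ cs.rightInvSeq ω) (h : signT hn cs r ≠ 1) : r ∈ tReflections hn cs := by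
  induction ω with
  | nil => simp at hr
  | cons i ω ih =>
    rw [CoxeterSystem.rightInvSeq, List.mem_cons] at hr
    rcases hr with rfl | hr
    · rw [map_mul, map_mul, map_inv, mul_comm, mul_inv_cancel_left, signT_simple] at h
      have hi : i = tIndex hn := by
        by_contra hi
        exact h (by rw [if_neg hi]; rfl)
      subst hi
      have := conj_mem_tReflections hn cs (t_mem_tReflections hn cs) (cs.wordProd ω)⁻¹
      rwa [inv_inv] at this
    · exact ih hr

theorem signT_ne_one_of_mem_tReflections {r : W} (hr : r ∈ tReflections hn cs) :
    signT hn cs r ≠ 1 := by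
  obtain ⟨m, hm, rfl⟩ := (mem_tReflections hn cs).mp hr
  clear hr
  induction m with
  | zero =>
    rw [jucysMurphy, node, signT_simple, if_pos (nodeIndex_zero hn)]
    decide
  | succ m ih =>
    rw [jucysMurphy, map_mul, map_mul, mul_comm, ← mul_assoc, ← map_mul, node_mul_self, map_one,
      one_mul]
    exact ih (by omega)

/-- A right inversion is conjugate to a simple reflection, and the character `signT` detects whether
that reflection is t. Counting inversions in a fixed set makes ℓ_t accessible to the cocycle rule.
-/
theorem lengthT_eq_card (w : W) : lengthT hn cs w =
    ((tReflections hn cs).filter fun r => invParity cs w r = 1).card := by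
  classical
  obtain ⟨ω, hω, rfl⟩ := cs.exists_isReduced w
  rw [lengthT_wordProd hn cs hω, ← countP_rightInvSeq hn cs, List.countP_eq_length_filter,
    ← List.toFinset_card_of_nodup ((hω.nodup_rightInvSeq cs).filter _)]
  congr 1
  ext r
  rw [List.mem_toFinset, List.mem_filter, Finset.mem_filter, invParity_eq_ite cs hω, decide_eq_true_iff]
  constructor
  · rintro ⟨h1, h2⟩
    exact ⟨mem_tReflections_of_mem_rightInvSeq hn cs h1 h2, if_pos h1⟩
  · rintro ⟨h1, h2⟩
    refine ⟨?_, signT_ne_one_of_mem_tReflections hn cs h1⟩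
    by_contra h3
    rw [if_neg h3] at h2
    exact absurd h2 (by decide)

theorem lengthT_signWord : lengthT hn cs (cs.wordProd (signWord hn n)) = n := by
  rw [lengthT_wordProd hn cs (isReduced_signWord hn cs le_rfl), count_signWord hn le_rfl]

/-- The n products need not be shown distinct directly: the sign word inverts n conjugates of t, so
there are at least n of them. -/
theorem card_tReflections : (tReflections hn cs).card = n := by
  classical
  apply le_antisymm
  · exact Finset.card_image_le.trans (Finset.card_range n).le
  · conv_lhs => rw [← lengthT_signWord hn cs, lengthT_eq_card]
    exact Finset.card_filter_le _ _

theorem lengthT_le (w : W) : lengthT hn cs w ≤ n := by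
  rw [lengthT_eq_card]
  exact (Finset.card_filter_le _ _).trans (card_tReflections hn cs).le

theorem lengthT_eq_iff (w : W) :
    lengthT hn cs w = n ↔ ∀ r ∈ tReflections hn cs, invParity cs w r = 1 := by
  rw [lengthT_eq_card]
  refine Iff.trans ?_ Finset.card_filter_eq_iff
  exact ⟨fun h => h.trans (card_tReflections hn cs).symm,
    fun h => h.trans (card_tReflections hn cs)⟩

theorem exists_jucysMurphy_eq_conj {m : ℕ} (hm : m < n) : ∃ ω : List (Fin n),
    (∀ i ∈ ω, i ≠ tIndex hn) ∧ jucysMurphy (node hn cs) m =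
      (cs.wordProd ω)⁻¹ * cs.simple (tIndex hn) * cs.wordProd ω := by
  induction m with
  | zero => exact ⟨[], by simp, by simp; rfl⟩
  | succ m ih =>
    obtain ⟨ω, h1, h2⟩ := ih (by omega)
    refine ⟨ω ++ [nodeIndex hn (m + 1)], ?_, ?_⟩
    · intro i hi
      rcases List.mem_append.mp hi with hi | hi
      · exact h1 i hi
      · rw [List.mem_singleton.mp hi]
        exact nodeIndex_ne_tIndex hn (by omega) hm
    · rw [jucysMurphy, h2, cs.wordProd_append, cs.wordProd_singleton, mul_inv_rev, cs.inv_simple, node]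
      simp only [mul_assoc]

theorem invParity_wordProd_eq_zero {ω : List (Fin n)} (hω : ∀ i ∈ ω, i ≠ tIndex hn) {r : W}
    (hr : r ∈ tReflections hn cs) : invParity cs (cs.wordProd ω) r = 0 := by
  classical
  rw [invParity_wordProd, List.count_eq_zero_of_not_mem, Nat.cast_zero]
  intro h
  have h1 := countP_rightInvSeq hn cs ω
  rw [List.count_eq_zero_of_not_mem (fun h => hω _ h rfl), List.countP_eq_zero] at h1
  exact h1 r h (by simpa using signT_ne_one_of_mem_tReflections hn cs hr)

/-- If `ℓ_t(w) < n`, some element of `𝔖_n w` is made longer by `t`. -/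
theorem exists_length_lt_t_mul {w : W} (hw : lengthT hn cs w ≠ n) : ∃ ω : List (Fin n),
    (∀ i ∈ ω, i ≠ tIndex hn) ∧ cs.length (cs.wordProd ω * w) <
      cs.length (cs.simple (tIndex hn) * (cs.wordProd ω * w)) := by
  by_contra! h
  apply hw
  rw [← lengthT_inv, lengthT_eq_iff]
  intro r hr
  obtain ⟨m, hm, rfl⟩ := (mem_tReflections hn cs).mp hr
  obtain ⟨ω, h1, h2⟩ := exists_jucysMurphy_eq_conj hn cs hm
  have h3 := h ω h1
  have h4 := cs.length_simple_mul_ne (cs.wordProd ω * w) (tIndex hn)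
  have h5 : cs.length ((w⁻¹ * cs.wordProd ω.reverse) * cs.simple (tIndex hn)) <
      cs.length (w⁻¹ * cs.wordProd ω.reverse) := by
    rw [← cs.length_inv, ← cs.length_inv (w⁻¹ * _)]
    simp only [mul_inv_rev, cs.wordProd_reverse, inv_inv, cs.inv_simple]
    omega
  -- A word without t inverts no conjugate of t, so the cocycle reduces the descent condition to the
  -- statement that w⁻¹ inverts ω⁻¹ t ω. These conjugates run through all of `tReflections`.
  rw [length_mul_simple_lt_iff, invParity_mul, invParity_wordProd_eq_zero hn cs
    (by simpa using h1) (t_mem_tReflections hn cs), zero_add, cs.wordProd_reverse, inv_inv] at h5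
  rw [h2]
  exact h5

/-- The elements with `ℓ_t(w) = n` form a single right coset of `𝔖_n`. -/
theorem exists_eq_wordProd_mul {w w' : W} (hw : lengthT hn cs w = n) (hw' : lengthT hn cs w' = n) :
    ∃ ω : List (Fin n), (∀ i ∈ ω, i ≠ tIndex hn) ∧ w = cs.wordProd ω * w' := by
  -- Both factors invert every conjugate of t, and 1 + 1 = 0, so the product inverts none.
  have h0 : lengthT hn cs (w * w'⁻¹) = 0 := by
    rw [lengthT_eq_card, Finset.card_eq_zero, Finset.filter_eq_empty_iff]
    intro r hr
    have h1 := (lengthT_eq_iff hn cs w).mp hw _ (conj_mem_tReflections hn cs hr w'⁻¹)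
    have h2 := (lengthT_eq_iff hn cs w'⁻¹).mp (by rw [lengthT_inv, hw']) r hr
    rw [invParity_mul, h1, h2]
    decide
  obtain ⟨ω, hω, h⟩ := cs.exists_isReduced (w * w'⁻¹)
  refine ⟨ω, ?_, by rw [← h, inv_mul_cancel_right]⟩
  rw [h, lengthT_wordProd hn cs hω, List.count_eq_zero] at h0
  rintro i hi rfl
  exact h0 hi

end TypeB

/-! ### Coefficients and the bar involution in a general Hecke algebra. -/

namespace Hecke

variable {B W Γ : Type*} [Group W] {M : CoxeterMatrix B} {cs : CoxeterSystem M W}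
  [AddCommGroup Γ] [LinearOrder Γ] (L : WeightFunction cs Γ)

theorem coord_zero (w : W) : coord L 0 w = 0 := by rw [coord, map_zero]; rfl

theorem coord_add (x y : Hecke cs L) (w : W) :
    coord L (x + y) w = coord L x w + coord L y w := by
  rw [coord, map_add]; rfl

theorem coord_sub (x y : Hecke cs L) (w : W) :
    coord L (x - y) w = coord L x w - coord L y w := by
  rw [coord, map_sub]; rfl

theorem coord_smul (a : Ground Γ) (x : Hecke cs L) (w : W) :
    coord L (a • x) w = a * coord L x w := by
  rw [coord, map_smul]; rfl

open Classical in
theorem coord_T (w y : W) : coord L (T L w) y = if w = y then 1 else 0 := by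
  rw [coord, T, Module.Basis.repr_self, Finsupp.single_apply]

theorem coord_T_self (w : W) : coord L (T L w) w = 1 := by
  classical
  rw [coord_T, if_pos rfl]

theorem coord_T_of_ne {w y : W} (h : w ≠ y) : coord L (T L w) y = 0 := by
  classical
  rw [coord_T, if_neg h]

theorem eq_zero_of_coord {x : Hecke cs L} (h : ∀ w, coord L x w = 0) : x = 0 := by
  apply (basis L).repr.injective
  rw [map_zero]
  exact Finsupp.ext h

theorem T_induction {p : Hecke cs L → Prop} (h0 : p 0) (hT : ∀ w, p (T L w))
    (hadd : ∀ x y, p x → p y → p (x + y)) (hsmul : ∀ (a : Ground Γ) x, p x → p (a • x))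
    (x : Hecke cs L) : p x := by
  have hs : x ∈ Submodule.span (Ground Γ) (Set.range (basis L)) := by
    rw [(basis L).span_eq]; trivial
  induction hs using Submodule.span_induction with
  | mem x hx => obtain ⟨w, rfl⟩ := hx; exact hT w
  | zero => exact h0
  | add x y _ _ hx hy => exact hadd x y hx hy
  | smul a x _ hx => exact hsmul a x hx

theorem T_simple_mul_up {i : B} {w : W} (h : cs.length w < cs.length (cs.simple i * w)) :
    T L (cs.simple i) * T L w = T L (cs.simple i * w) := by
  rw [T_simple_mul, lmul_up L h]

theorem T_simple_mul_down {i : B} {w : W} (h : cs.length (cs.simple i * w) < cs.length w) :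
    T L (cs.simple i) * T L w = T L (cs.simple i * w) + xi L i • T L w := by
  rw [T_simple_mul, lmul_down L h]

theorem coord_T_simple_mul (i : B) (x : Hecke cs L) (w : W) :
    coord L (T L (cs.simple i) * x) w = coord L x (cs.simple i * w) +
      if cs.length (cs.simple i * w) < cs.length w then xi L i * coord L x w else 0 := by
  induction x using T_induction L with
  | h0 => simp [coord_zero]
  | hadd x y hx hy =>
    rw [mul_add, coord_add, hx, hy, coord_add, coord_add]
    split_ifs <;> ring
  | hsmul a x hx =>
    rw [mul_smul_comm, coord_smul, hx, coord_smul, coord_smul]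
    split_ifs <;> ring
  | hT y =>
    have hy : cs.simple i * y = w ↔ y = cs.simple i * w := by
      constructor <;> rintro rfl <;> simp
    rcases Nat.lt_or_ge (cs.length y) (cs.length (cs.simple i * y)) with h | h
    · rw [T_simple_mul_up L h]
      by_cases hw : y = w
      · subst hw
        rw [if_neg (by omega), add_zero]
        classical
        simp only [coord_T, hy]
      · rw [coord_T_of_ne L hw, mul_zero, ite_self, add_zero]
        classical
        simp only [coord_T, hy]
    · have h' : cs.length (cs.simple i * y) < cs.length y :=
        lt_of_le_of_ne h (cs.length_simple_mul_ne y i)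
      rw [T_simple_mul_down L h', coord_add, coord_smul]
      classical
      simp only [coord_T, hy]
      congr 1
      by_cases hw : y = w
      · subst hw; simp [h']
      · simp [hw]

/-- The inverse of `T_s`. -/
noncomputable def Tinv (i : B) : Hecke cs L := T L (cs.simple i) - xi L i • 1

theorem T_mul_Tinv (i : B) : T L (cs.simple i) * Tinv L i = 1 := by
  have h := T_simple_sq L i
  rw [pow_two] at h
  rw [Tinv, mul_sub, h, mul_smul_comm, mul_one, xi, add_sub_cancel_right]

theorem Tinv_mul_T (i : B) : Tinv L i * T L (cs.simple i) = 1 := by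
  have h := T_simple_sq L i
  rw [pow_two] at h
  rw [Tinv, sub_mul, h, smul_mul_assoc, one_mul, xi, add_sub_cancel_right]

theorem Tinv_mul_eq (i : B) (x : Hecke cs L) :
    Tinv L i * x = T L (cs.simple i) * x - xi L i • x := by
  rw [Tinv, sub_mul, smul_mul_assoc, one_mul]

theorem T_simple_mul_eq (i : B) (x : Hecke cs L) :
    T L (cs.simple i) * x = Tinv L i * x + xi L i • x := by
  rw [Tinv_mul_eq, sub_add_cancel]

theorem groundBar_xi (i : B) : groundBar (xi L i) = - xi L i := by
  rw [xi, map_sub, groundBar_vpow, groundBar_vpow, neg_neg, neg_sub]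

theorem T_wordProd {ω : List B} (h : cs.IsReduced ω) :
    T L (cs.wordProd ω) = (ω.map fun i => T L (cs.simple i)).prod := by
  induction ω with
  | nil => rw [cs.wordProd_nil, ← one_def]; rfl
  | cons i ω ih =>
    have hr : cs.IsReduced ω := h.drop 1
    rw [List.map_cons, List.prod_cons, ← ih hr, cs.wordProd_cons, T_simple_mul_up]
    have := h.eq
    rw [cs.wordProd_cons] at this
    rw [this, hr.eq]
    exact Nat.lt_succ_self _

theorem bar_zero : bar L 0 = 0 := by
  rw [bar, map_zero, Finsupp.sum_zero_index]

theorem bar_add (x y : Hecke cs L) : bar L (x + y) = bar L x + bar L y := by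
  rw [bar, map_add, Finsupp.sum_add_index']
  · rfl
  · intro w; rw [map_zero, zero_smul]
  · intro w a b; rw [map_add, add_smul]

theorem bar_smul (a : Ground Γ) (x : Hecke cs L) : bar L (a • x) = groundBar a • bar L x := by
  rw [bar, map_smul, Finsupp.sum_smul_index, bar, Finsupp.smul_sum]
  · simp only [map_mul, smul_smul]
  · intro w; rw [map_zero, zero_smul]

theorem bar_sub (x y : Hecke cs L) : bar L (x - y) = bar L x - bar L y := by
  rw [eq_sub_iff_add_eq, ← bar_add, sub_add_cancel]

theorem bar_T (w : W) : bar L (T L w) = Ring.inverse (T L w⁻¹) := by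
  rw [bar, T, Module.Basis.repr_self, Finsupp.sum_single_index]
  · rw [map_one, one_smul]
  · rw [map_zero, zero_smul]

theorem bar_one : bar L 1 = 1 := by
  rw [one_def, bar_T, inv_one, ← one_def, Ring.inverse_one]

theorem bar_T_simple_mul_up {i : B} {w : W} (h : cs.length w < cs.length (cs.simple i * w)) :
    bar L (T L (cs.simple i * w)) = Tinv L i * bar L (T L w) := by
  have h1 : cs.length (cs.simple i * w) = cs.length w + 1 := by
    rcases cs.length_simple_mul w i with h | h <;> omega
  have h2 : T L (cs.simple i * w)⁻¹ = T L w⁻¹ * T L (cs.simple i) := by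
    rw [mul_inv_rev, cs.inv_simple, T_mul_T]
    rw [← cs.length_inv]
    simp [h1]
  rw [bar_T, bar_T, h2, Ring.inverse_mul (Or.inl (isUnit_T L _))]
  congr 1
  have := Ring.mul_inverse_cancel _ (isUnit_T_simple L i)
  rw [← one_mul (Ring.inverse _), ← Tinv_mul_T L i, mul_assoc, this, mul_one]

/-- Full multiplicativity of bar is not needed: this rule for the generators suffices for everything
that follows. When s shortens w, it rests on ξ_s being anti-invariant. -/
theorem bar_T_simple_mul (i : B) (x : Hecke cs L) :
    bar L (T L (cs.simple i) * x) = Tinv L i * bar L x := by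
  induction x using T_induction L with
  | h0 => rw [mul_zero, bar_zero, mul_zero]
  | hadd x y hx hy => rw [mul_add, bar_add, hx, hy, bar_add, mul_add]
  | hsmul a x hx => rw [mul_smul_comm, bar_smul, hx, bar_smul, mul_smul_comm]
  | hT w =>
    rcases Nat.lt_or_ge (cs.length w) (cs.length (cs.simple i * w)) with h | h
    · rw [T_simple_mul_up L h, bar_T_simple_mul_up L h]
    · have h' : cs.length (cs.simple i * w) < cs.length w :=
        lt_of_le_of_ne h (cs.length_simple_mul_ne w i)
      have h1 := bar_T_simple_mul_up L (i := i) (w := cs.simple i * w) (by simpa using h')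
      rw [cs.simple_mul_simple_cancel_left] at h1
      have h2 : bar L (T L (cs.simple i * w)) = T L (cs.simple i) * bar L (T L w) := by
        rw [h1, ← mul_assoc, T_mul_Tinv, one_mul]
      rw [T_simple_mul_down L h', bar_add, bar_smul, h2, groundBar_xi, Tinv_mul_eq, neg_smul,
        sub_eq_add_neg]

theorem bar_Tinv_mul (i : B) (x : Hecke cs L) :
    bar L (Tinv L i * x) = T L (cs.simple i) * bar L x := by
  rw [Tinv_mul_eq, bar_sub, bar_T_simple_mul, bar_smul, groundBar_xi, neg_smul, sub_neg_eq_add,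
    ← T_simple_mul_eq]

theorem bar_bar (x : Hecke cs L) : bar L (bar L x) = x := by
  induction x using T_induction L with
  | h0 => rw [bar_zero, bar_zero]
  | hadd x y hx hy => rw [bar_add, bar_add, hx, hy]
  | hsmul a x hx => rw [bar_smul, bar_smul, hx, groundBar_groundBar]
  | hT w =>
    obtain ⟨ω, hω, rfl⟩ := cs.exists_isReduced w
    rw [T_wordProd L hω]
    clear hω
    induction ω with
    | nil => simp [bar_one]
    | cons i ω ih => rw [List.map_cons, List.prod_cons, bar_T_simple_mul, bar_Tinv_mul, ih]

theorem coord_bar (x : Hecke cs L) (y : W) : coord L (bar L x) y =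
    ((basis L).repr x).sum fun w a => groundBar a * coord L (bar L (T L w)) y := by
  have h : ∀ z, coord L z y = (basis L).coord y z := fun z => rfl
  rw [h, bar, map_finsuppSum]
  simp only [← h, coord_smul, bar_T]

theorem coord_bar_eq_zero {x : Hecke cs L} {y : W}
    (h : ∀ w, coord L x w ≠ 0 → coord L (bar L (T L w)) y = 0) : coord L (bar L x) y = 0 := by
  rw [coord_bar]
  apply Finset.sum_eq_zero
  intro w hw
  dsimp only
  rw [h w (Finsupp.mem_support_iff.mp hw), mul_zero]

/-- `bar T_w` is the sum of `T_w` and a combination of `T_y` with `ℓ(y) < ℓ(w)`. -/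
theorem coord_bar_T_sub {w y : W} (h : cs.length w ≤ cs.length y) :
    coord L (bar L (T L w) - T L w) y = 0 := by
  obtain ⟨ω, hω, rfl⟩ := cs.exists_isReduced w
  induction ω generalizing y with
  | nil => rw [cs.wordProd_nil, ← one_def, bar_one, sub_self, coord_zero]
  | cons i ω ih =>
    have hr : cs.IsReduced ω := hω.drop 1
    have hl : cs.length (cs.simple i * cs.wordProd ω) = cs.length (cs.wordProd ω) + 1 := by
      have := hω.eq
      rw [cs.wordProd_cons] at this
      rw [this, hr.eq, List.length_cons]
    rw [cs.wordProd_cons] at h ⊢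
    rw [← T_simple_mul_up L (by omega), bar_T_simple_mul, Tinv_mul_eq]
    set d := bar L (T L (cs.wordProd ω)) - T L (cs.wordProd ω) with hd
    have e : bar L (T L (cs.wordProd ω)) = d + T L (cs.wordProd ω) := by rw [hd, sub_add_cancel]
    have e2 : T L (cs.simple i) * bar L (T L (cs.wordProd ω)) -
        xi L i • bar L (T L (cs.wordProd ω)) - T L (cs.simple i) * T L (cs.wordProd ω) =
        T L (cs.simple i) * d - xi L i • d - xi L i • T L (cs.wordProd ω) := by
      rw [e, mul_add, smul_add]; abel
    have h1 := cs.length_simple_mul y i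
    rw [e2, coord_sub, coord_sub, coord_T_simple_mul, coord_smul, coord_smul,
      ih hr (by omega), ih hr (by omega), coord_T_of_ne]
    · simp
    · rintro rfl; omega

theorem coord_bar_T_of_ne {w y : W} (h : cs.length w ≤ cs.length y) (hne : w ≠ y) :
    coord L (bar L (T L w)) y = 0 := by
  have := coord_bar_T_sub L h
  rwa [coord_sub, coord_T_of_ne L hne, sub_zero] at this

theorem coord_bar_eq {x : Hecke cs L} {y : W}
    (h : ∀ w, w ≠ y → coord L x w ≠ 0 → coord L (bar L (T L w)) y = 0) :
    coord L (bar L x) y = groundBar (coord L x y) := by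
  have h1 := coord_bar_T_sub L (w := y) le_rfl
  rw [coord_sub, coord_T_self, sub_eq_zero] at h1
  have h2 : coord L (bar L (x - coord L x y • T L y)) y = 0 := by
    apply coord_bar_eq_zero
    intro w hw
    rw [coord_sub, coord_smul] at hw
    by_cases hwy : w = y
    · subst hwy
      rw [coord_T_self, mul_one, sub_self] at hw
      exact absurd rfl hw
    · rw [coord_T_of_ne L (Ne.symm hwy), mul_zero, sub_zero] at hw
      exact h w hwy hw
  rw [bar_sub, bar_smul, coord_sub, coord_smul, h1, mul_one, sub_eq_zero] at h2
  exact h2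

/-- A bar-invariant element with negative coefficients vanishes. -/
theorem eq_zero_of_isNegative [IsOrderedAddMonoid Γ] {x : Hecke cs L} (hb : bar L x = x)
    (hx : ∀ y, IsNegative (coord L x y)) : x = 0 := by
  by_contra h0
  have hne : ((basis L).repr x).support.Nonempty := by
    rw [Finset.nonempty_iff_ne_empty, ne_eq, Finsupp.support_eq_empty]
    intro h
    exact h0 ((basis L).repr.injective (by rw [h, map_zero]))
  -- At an element of maximal length in the support, bar acts on the coefficient as `groundBar`, so
  -- that coefficient is both invariant and negative.
  obtain ⟨y, hy, hmax⟩ := Finset.exists_max_image _ cs.length hne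
  have h1 : coord L (bar L x) y = groundBar (coord L x y) := by
    apply coord_bar_eq
    intro w hw hw'
    exact coord_bar_T_of_ne L (hmax w (Finsupp.mem_support_iff.mpr hw')) hw
  rw [hb] at h1
  exact Finsupp.mem_support_iff.mp hy ((hx y).eq_zero h1.symm)

theorem IsKazhdanLusztig.unique [IsOrderedAddMonoid Γ] {w : W} {c c' : Hecke cs L}
    (h : IsKazhdanLusztig L w c) (h' : IsKazhdanLusztig L w c') : c = c' := by
  rw [← sub_eq_zero]
  apply eq_zero_of_isNegative L
  · rw [bar_sub, h.1, h'.1]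
  · intro y
    have := (h.2 y).sub (h'.2 y)
    rwa [← coord_sub, sub_sub_sub_cancel_right] at this

end Hecke

open Hecke

/-! ### Jucys–Murphy elements and their product in the Hecke algebra. -/

section JucysMurphy

variable {n : ℕ} (hn : 1 ≤ n) {W : Type*} [Group W] (cs : CoxeterSystem (CoxeterMatrix.B n) W)

theorem weightB_t : (weightB hn cs).toFun (cs.simple (tIndex hn)) = toLex ((1 : ℤ), (0 : ℤ)) := by
  simp [weightB, lengthT_simple]

theorem weightB_s {i : Fin n} (hi : i ≠ tIndex hn) :
    (weightB hn cs).toFun (cs.simple i) = toLex ((0 : ℤ), (1 : ℤ)) := by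
  simp [weightB, lengthT_simple, hi]

/-- The element `V⁻¹` of the ground ring. -/
noncomputable def Vinv : Ground (ℤ ×ₗ ℤ) := vpow (-toLex ((1 : ℤ), (0 : ℤ)))

theorem Vinv_mul_V : Vinv * V = 1 := vpow_neg_mul_vpow _

theorem groundBar_V : groundBar V = Vinv := groundBar_vpow _

theorem groundBar_Vinv : groundBar Vinv = V := by
  rw [← groundBar_V, groundBar_groundBar]

theorem xi_t : xi (weightB hn cs) (tIndex hn) = V - Vinv := by
  rw [xi, weightB_t]; rfl

/-- The generators of the Hecke algebra, indexed by the distance from `t`. -/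
noncomputable def nodeT (j : ℕ) : HeckeB hn cs := T (weightB hn cs) (node hn cs j)

theorem nodeT_zero : nodeT hn cs 0 = Tt hn cs := rfl

theorem nodeT_sq (j : ℕ) : nodeT hn cs j * nodeT hn cs j =
    1 + xi (weightB hn cs) (nodeIndex hn j) • nodeT hn cs j := by
  rw [← pow_two]; exact T_simple_sq _ _

theorem prod_T_eq_of_wordProd_eq {B W Γ : Type*} [Group W] {M : CoxeterMatrix B}
    {cs : CoxeterSystem M W} [AddCommGroup Γ] [LinearOrder Γ] (L : WeightFunction cs Γ)
    {ω ω' : List B} (h : cs.IsReduced ω) (hl : ω.length = ω'.length)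
    (hw : cs.wordProd ω = cs.wordProd ω') :
    (ω.map fun i => T L (cs.simple i)).prod = (ω'.map fun i => T L (cs.simple i)).prod := by
  have h' : cs.IsReduced ω' := by
    rw [CoxeterSystem.IsReduced, ← hw, h.eq, hl]
  rw [← T_wordProd L h, ← T_wordProd L h', hw]

/-- Two reduced words of the same element give the same product of generators, so the relations of W
lift once one side is known to be reduced. For the long relations this is read off from the sign
words. -/
theorem nodeT_isBraidB : IsBraidB n (nodeT hn cs) where
  four h := by
    have hb := (node_isBraidB hn cs).four h
    have := prod_T_eq_of_wordProd_eq (weightB hn cs) (isReduced_four hn cs h)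
      (ω' := [nodeIndex hn 0, nodeIndex hn 1, nodeIndex hn 0, nodeIndex hn 1]) rfl (by
        simp only [node, mul_assoc] at hb
        simp only [cs.wordProd_cons, cs.wordProd_nil, mul_one, hb])
    simp only [List.map_cons, List.map_nil, List.prod_cons, List.prod_nil, mul_one] at this
    simp only [nodeT, node, mul_assoc]
    exact this.symm
  three i h1 h2 := by
    have hb := (node_isBraidB hn cs).three i h1 h2
    have := prod_T_eq_of_wordProd_eq (weightB hn cs) (isReduced_three hn cs h1 h2)
      (ω' := [nodeIndex hn (i + 1), nodeIndex hn i, nodeIndex hn (i + 1)]) rfl (by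
        simp only [node, mul_assoc] at hb
        simp only [cs.wordProd_cons, cs.wordProd_nil, mul_one, hb])
    simp only [List.map_cons, List.map_nil, List.prod_cons, List.prod_nil, mul_one] at this
    simp only [nodeT, node, mul_assoc]
    exact this
  comm i j h1 h2 := by
    have hb := (node_isBraidB hn cs).comm i j h1 h2
    rcases cs.length_simple_mul (cs.simple (nodeIndex hn j)) (nodeIndex hn i) with h | h
    · have := prod_T_eq_of_wordProd_eq (weightB hn cs) (ω := [nodeIndex hn i, nodeIndex hn j])
        (by simpa [CoxeterSystem.IsReduced, cs.wordProd_cons] using h)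
        (ω' := [nodeIndex hn j, nodeIndex hn i]) rfl (by
          simp only [cs.wordProd_cons, cs.wordProd_nil, mul_one]
          exact hb)
      simp only [List.map_cons, List.map_nil, List.prod_cons, List.prod_nil, mul_one] at this
      exact this
    -- If the product of the two generators is not of length 2, it is 1; the generators then
    -- coincide and commute trivially.
    · have h0 : cs.simple (nodeIndex hn i) * cs.simple (nodeIndex hn j) = 1 := by
        rw [← cs.length_eq_zero_iff]
        rw [cs.length_simple] at h
        omega
      rw [mul_eq_one_iff_eq_inv, cs.inv_simple] at h0
      rw [nodeT, nodeT, node, node, h0]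
      exact Commute.refl _

theorem prod_T_palindrome (m : ℕ) :
    ((palindrome hn m).map fun i => T (weightB hn cs) (cs.simple i)).prod =
      jucysMurphy (nodeT hn cs) m := by
  induction m with
  | zero => simp [palindrome, jucysMurphy]; rfl
  | succ m ih =>
    rw [palindrome, List.concat_eq_append, List.map_cons, List.map_append, List.prod_cons,
      List.prod_append, ih, jucysMurphy, mul_assoc]
    simp; rfl

theorem T_signWord_succ {m : ℕ} (hm : m < n) :
    T (weightB hn cs) (cs.wordProd (signWord hn (m + 1))) =
      jucysMurphy (nodeT hn cs) m * T (weightB hn cs) (cs.wordProd (signWord hn m)) := by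
  rw [T_wordProd _ (isReduced_signWord hn cs hm),
    T_wordProd _ (isReduced_signWord hn cs (m := m) (by omega)), signWord, List.map_append,
    List.prod_append, prod_T_palindrome]

/-- The product of the `L_i + V⁻¹` for `i < m`. -/
noncomputable def murphyProd : ℕ → HeckeB hn cs
  | 0 => 1
  | m + 1 => (jucysMurphy (nodeT hn cs) m + algebraMap _ _ Vinv) * murphyProd m

theorem nodeT_commute_murphyProd_of_gt {m j : ℕ} (hmj : m < j) (hj : j < n) :
    Commute (nodeT hn cs j) (murphyProd hn cs m) := by
  induction m with
  | zero => exact Commute.one_right _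
  | succ m ih =>
    exact (((nodeT_isBraidB hn cs).commute_of_lt hmj hj).add_right
      (Algebra.commute_algebraMap_right _ _)).mul_right (ih (by omega))

/-- The quadratic relation makes g commute with the sum of a and gag, and their commutation makes g
commute with their product. Hence g commutes with (gag + c)(a + c), though not in general with each
factor. -/
theorem commute_quadratic {A R : Type*} [CommRing A] [Ring R] [Algebra A R] {g a : R} {x c : A}
    (hg : g * g = 1 + x • g) (h : Commute a (g * a * g)) :
    Commute g ((g * a * g + algebraMap A R c) * (a + algebraMap A R c)) := by
  have h1 : g * (g * a * g * a) = g * a * g * a * g := by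
    calc g * (g * a * g * a) = g * (a * (g * a * g)) := by rw [h.eq]
      _ = g * a * g * a * g := by simp only [mul_assoc]
  have h2 : Commute g (g * a * g + a) := by
    have e1 : g * (g * a * g + a) = g * g * a * g + g * a := by simp only [mul_add, mul_assoc]
    have e2 : (g * a * g + a) * g = g * a * (g * g) + a * g := by simp only [add_mul, mul_assoc]
    rw [Commute, SemiconjBy, e1, e2, hg]
    simp only [add_mul, mul_add, one_mul, mul_one, smul_mul_assoc, mul_smul_comm]
    abel
  have e : (g * a * g + algebraMap A R c) * (a + algebraMap A R c) =
      g * a * g * a + c • (g * a * g + a) + algebraMap A R (c * c) := by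
    simp only [mul_add, add_mul, Algebra.algebraMap_eq_smul_one, smul_mul_assoc, mul_smul_comm,
      one_mul, mul_one, smul_add, mul_smul]
    abel
  rw [e]
  exact ((show Commute g (g * a * g * a) from h1).add_right (h2.smul_right c)).add_right
    (Algebra.commute_algebraMap_right _ _)

/-- The generator j commutes with each factor except those of index j - 1 and j, and with the
product of these two by `commute_quadratic`. -/
theorem nodeT_commute_murphyProd {m j : ℕ} (h0 : 0 < j) (hj : j < m) (hm : m ≤ n) :
    Commute (nodeT hn cs j) (murphyProd hn cs m) := by
  induction m with
  | zero => omega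
  | succ m ih =>
    rcases Nat.lt_succ_iff_lt_or_eq.mp hj with h | rfl
    · exact (((nodeT_isBraidB hn cs).commute_of_gt h (by omega)).add_right
        (Algebra.commute_algebraMap_right _ _)).mul_right (ih h (by omega))
    · obtain ⟨j, rfl⟩ := Nat.exists_eq_add_of_le' h0
      have hc := (nodeT_isBraidB hn cs).jucysMurphy_commute_of_lt (i := j) (j := j + 1) (by omega) hm
      have hL : jucysMurphy (nodeT hn cs) (j + 1) =
        nodeT hn cs (j + 1) * jucysMurphy (nodeT hn cs) j * nodeT hn cs (j + 1) := rfl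
      rw [hL] at hc
      have h1 := commute_quadratic (c := Vinv) (nodeT_sq hn cs (j + 1)) hc
      have h2 := nodeT_commute_murphyProd_of_gt hn cs (m := j) (j := j + 1) (by omega) hm
      rw [murphyProd, murphyProd, ← mul_assoc, hL]
      exact h1.mul_right h2

/-- T_t commutes with every L_m, m > 0, so T_t - V can be moved to the factor T_t + V⁻¹, where the
quadratic relation gives 0. -/
theorem Tt_sub_mul_murphyProd {m : ℕ} (h0 : 0 < m) (hm : m ≤ n) :
    (Tt hn cs - algebraMap _ _ V) * murphyProd hn cs m = 0 := by
  induction m with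
  | zero => omega
  | succ m ih =>
    rcases Nat.eq_zero_or_pos m with rfl | h
    · rw [murphyProd, murphyProd, mul_one, jucysMurphy, nodeT_zero]
      have h1 := nodeT_sq hn cs 0
      rw [nodeIndex_zero, xi_t, nodeT_zero] at h1
      simp only [sub_mul, mul_add, h1, Algebra.algebraMap_eq_smul_one, smul_mul_assoc,
        mul_smul_comm, one_mul, mul_one, smul_sub, smul_smul, Vinv_mul_V, sub_smul, one_smul]
      abel
    · have hc : Commute (Tt hn cs) (jucysMurphy (nodeT hn cs) m) :=
        (nodeT_isBraidB hn cs).commute_of_gt (j := 0) h hm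
      have hc' : Commute (Tt hn cs - algebraMap _ _ V)
          (jucysMurphy (nodeT hn cs) m + algebraMap _ _ Vinv) :=
        (hc.sub_left (Algebra.commute_algebraMap_left _ _)).add_right
          (Algebra.commute_algebraMap_right _ _)
      rw [murphyProd, ← mul_assoc, hc'.eq, mul_assoc, ih h (by omega), mul_zero]

/-- The span of the `T_w` with `ℓ_t(w) < k`. -/
noncomputable def lowT (k : ℕ) : Submodule (Ground (ℤ ×ₗ ℤ)) (HeckeB hn cs) where
  carrier := {x | ∀ w, k ≤ lengthT hn cs w → coord (weightB hn cs) x w = 0}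
  zero_mem' := fun w _ => coord_zero _ w
  add_mem' := by
    intro x y hx hy w hw
    rw [coord_add, hx w hw, hy w hw, add_zero]
  smul_mem' := by
    intro a x hx w hw
    rw [coord_smul, hx w hw, mul_zero]

theorem lowT_mono {k l : ℕ} (h : k ≤ l) : lowT hn cs k ≤ lowT hn cs l :=
  fun _ hx w hw => hx w (h.trans hw)

theorem T_mem_lowT {k : ℕ} {w : W} (h : lengthT hn cs w < k) :
    T (weightB hn cs) w ∈ lowT hn cs k := by
  intro y hy
  apply coord_T_of_ne
  rintro rfl
  omega

theorem T_s_mul_mem_lowT {k : ℕ} {i : Fin n} (hi : i ≠ tIndex hn) {x : HeckeB hn cs}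
    (hx : x ∈ lowT hn cs k) : T (weightB hn cs) (cs.simple i) * x ∈ lowT hn cs k := by
  intro w hw
  rw [coord_T_simple_mul, hx w hw, hx _ (by rwa [lengthT_simple_mul hn cs hi]), mul_zero, ite_self,
    add_zero]

theorem Tt_mul_mem_lowT {k : ℕ} {x : HeckeB hn cs}
    (hx : x ∈ lowT hn cs k) : Tt hn cs * x ∈ lowT hn cs (k + 1) := by
  intro w hw
  have h : k ≤ lengthT hn cs (cs.simple (tIndex hn) * w) := by
    rcases Nat.lt_or_ge (cs.length w) (cs.length (cs.simple (tIndex hn) * w)) with h | h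
    · rw [lengthT_t_mul hn cs h]; omega
    · have h' : cs.length (cs.simple (tIndex hn) * w) < cs.length w :=
        lt_of_le_of_ne h (cs.length_simple_mul_ne w _)
      have := lengthT_t_mul hn cs (w := cs.simple (tIndex hn) * w) (by simpa using h')
      rw [cs.simple_mul_simple_cancel_left] at this
      omega
  rw [Tt, coord_T_simple_mul, hx w (by omega), hx _ h, mul_zero, ite_self, add_zero]

theorem jucysMurphy_mul_mem_lowT {k m : ℕ} (hm : m < n) {x : HeckeB hn cs}
    (hx : x ∈ lowT hn cs k) : jucysMurphy (nodeT hn cs) m * x ∈ lowT hn cs (k + 1) := by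
  induction m generalizing x with
  | zero => exact Tt_mul_mem_lowT hn cs hx
  | succ m ih =>
    have hi := nodeIndex_ne_tIndex hn (j := m + 1) (by omega) hm
    rw [jucysMurphy, mul_assoc, mul_assoc]
    exact T_s_mul_mem_lowT hn cs hi (ih (by omega) (T_s_mul_mem_lowT hn cs hi hx))

/-- Multiplication by L_m raises ℓ_t by at most one. When the product is expanded, only the term
taking L_m from every factor reaches ℓ_t = m, and it is T of the sign word. -/
theorem murphyProd_sub_mem_lowT {m : ℕ} (hm : m ≤ n) :
    murphyProd hn cs m - T (weightB hn cs) (cs.wordProd (signWord hn m)) ∈ lowT hn cs m := by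
  induction m with
  | zero =>
    rw [murphyProd, signWord, cs.wordProd_nil, ← one_def, sub_self]
    exact zero_mem _
  | succ m ih =>
    have h := ih (by omega)
    rw [T_signWord_succ hn cs hm, murphyProd]
    set d := murphyProd hn cs m - T (weightB hn cs) (cs.wordProd (signWord hn m)) with hd
    have e : murphyProd hn cs m = d + T (weightB hn cs) (cs.wordProd (signWord hn m)) := by
      rw [hd, sub_add_cancel]
    have e2 : (jucysMurphy (nodeT hn cs) m + algebraMap _ _ Vinv) * murphyProd hn cs m -
        jucysMurphy (nodeT hn cs) m * T (weightB hn cs) (cs.wordProd (signWord hn m)) =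
        jucysMurphy (nodeT hn cs) m * d + Vinv • d +
          Vinv • T (weightB hn cs) (cs.wordProd (signWord hn m)) := by
      rw [e, Algebra.algebraMap_eq_smul_one]
      simp only [add_mul, mul_add, smul_mul_assoc, one_mul]
      abel
    rw [e2]
    refine add_mem (add_mem (jucysMurphy_mul_mem_lowT hn cs hm h) ?_) ?_
    · exact Submodule.smul_mem _ _ (lowT_mono hn cs (Nat.le_succ m) h)
    · apply Submodule.smul_mem
      apply T_mem_lowT
      rw [lengthT_wordProd hn cs (isReduced_signWord hn cs (by omega)),
        count_signWord hn (by omega)]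
      omega

end JucysMurphy

/-- The preimage of a submodule under the bar involution. -/
noncomputable def Hecke.barPreimage {B W Γ : Type*} [Group W] {M : CoxeterMatrix B}
    {cs : CoxeterSystem M W} [AddCommGroup Γ] [LinearOrder Γ] (L : WeightFunction cs Γ)
    (P : Submodule (Ground Γ) (Hecke cs L)) : Submodule (Ground Γ) (Hecke cs L) where
  carrier := {h | bar L h ∈ P}
  zero_mem' := by
    change bar L 0 ∈ P
    rw [bar_zero]; exact zero_mem _
  add_mem' := by
    intro x y hx hy
    change bar L (x + y) ∈ P
    rw [bar_add]; exact add_mem hx hy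
  smul_mem' := by
    intro a x hx
    change bar L (a • x) ∈ P
    rw [bar_smul]; exact Submodule.smul_mem _ _ hx

theorem Hecke.mem_barPreimage {B W Γ : Type*} [Group W] {M : CoxeterMatrix B}
    {cs : CoxeterSystem M W} [AddCommGroup Γ] [LinearOrder Γ] (L : WeightFunction cs Γ)
    {P : Submodule (Ground Γ) (Hecke cs L)} {h : Hecke cs L} :
    h ∈ barPreimage L P ↔ bar L h ∈ P := Iff.rfl

/-! ### The annihilator as a bar-stable left ideal, and its coefficients. -/

section Annihilator

variable {n : ℕ} (hn : 1 ≤ n) {W : Type*} [Group W] (cs : CoxeterSystem (CoxeterMatrix.B n) W)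

/-- The elements `h` with `(T_t - V) x h = 0` for all `x ∈ H(𝔖_n)`. -/
noncomputable def symAnnihilator : Submodule (Ground (ℤ ×ₗ ℤ)) (HeckeB hn cs) where
  carrier := {h | ∀ x ∈ heckeSym hn cs, (Tt hn cs - algebraMap _ _ V) * x * h = 0}
  zero_mem' := fun x _ => mul_zero _
  add_mem' := by
    intro h h' hh hh' x hx
    rw [mul_add, hh x hx, hh' x hx, add_zero]
  smul_mem' := by
    intro a h hh x hx
    rw [mul_smul_comm, hh x hx, smul_zero]

theorem T_s_mem_heckeSym {i : Fin n} (hi : i ≠ tIndex hn) :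
    T (weightB hn cs) (cs.simple i) ∈ heckeSym hn cs :=
  Algebra.subset_adjoin ⟨i, hi, rfl⟩

theorem T_s_mul_mem_symAnnihilator {i : Fin n} (hi : i ≠ tIndex hn) {h : HeckeB hn cs}
    (hh : h ∈ symAnnihilator hn cs) :
    T (weightB hn cs) (cs.simple i) * h ∈ symAnnihilator hn cs := by
  intro x hx
  have := hh (x * T (weightB hn cs) (cs.simple i)) (mul_mem hx (T_s_mem_heckeSym hn cs hi))
  simpa only [mul_assoc] using this

theorem Tinv_mul_mem_symAnnihilator {i : Fin n} (hi : i ≠ tIndex hn) {h : HeckeB hn cs}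
    (hh : h ∈ symAnnihilator hn cs) :
    Tinv (weightB hn cs) i * h ∈ symAnnihilator hn cs := by
  rw [Tinv_mul_eq]
  exact sub_mem (T_s_mul_mem_symAnnihilator hn cs hi hh) (Submodule.smul_mem _ _ hh)

theorem Tt_mul_of_mem_symAnnihilator {h : HeckeB hn cs} (hh : h ∈ symAnnihilator hn cs) :
    Tt hn cs * h = V • h := by
  have := hh 1 (one_mem _)
  rwa [mul_one, sub_mul, sub_eq_zero, ← Algebra.smul_def] at this

/-- The annihilator is the largest submodule that is stable under the T_s and on which T_t acts as
V; this is the test used for bar-stability. -/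
theorem le_symAnnihilator {P : Submodule (Ground (ℤ ×ₗ ℤ)) (HeckeB hn cs)}
    (hs : ∀ i ≠ tIndex hn, ∀ h ∈ P, T (weightB hn cs) (cs.simple i) * h ∈ P)
    (ht : ∀ h ∈ P, Tt hn cs * h = V • h) : P ≤ symAnnihilator hn cs := by
  have key : ∀ x ∈ heckeSym hn cs, ∀ h ∈ P, x * h ∈ P := by
    intro x hx
    induction hx using Algebra.adjoin_induction with
    | mem x hx => obtain ⟨i, hi, rfl⟩ := hx; exact hs i hi
    | algebraMap r =>
      intro h hh
      rw [← Algebra.smul_def]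
      exact Submodule.smul_mem _ _ hh
    | add x y _ _ hx hy => intro h hh; rw [add_mul]; exact add_mem (hx h hh) (hy h hh)
    | mul x y _ _ hx hy => intro h hh; rw [mul_assoc]; exact hx _ (hy h hh)
  intro h hh x hx
  rw [mul_assoc, sub_mul, ht _ (key x hx h hh), Algebra.smul_def, sub_self]

/-- The annihilator is a left ideal of the whole Hecke algebra. -/
theorem mul_mem_symAnnihilator (x : HeckeB hn cs) {h : HeckeB hn cs}
    (hh : h ∈ symAnnihilator hn cs) : x * h ∈ symAnnihilator hn cs := by
  induction x using T_induction (weightB hn cs) with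
  | h0 => rw [zero_mul]; exact zero_mem _
  | hadd x y hx hy => rw [add_mul]; exact add_mem hx hy
  | hsmul a x hx => rw [smul_mul_assoc]; exact Submodule.smul_mem _ _ hx
  | hT w =>
    obtain ⟨ω, hω, rfl⟩ := cs.exists_isReduced w
    rw [T_wordProd _ hω]
    clear hω
    induction ω with
    | nil => simpa
    | cons i ω ih =>
      rw [List.map_cons, List.prod_cons, mul_assoc]
      by_cases hi : i = tIndex hn
      · subst hi
        have := Tt_mul_of_mem_symAnnihilator hn cs ih
        rw [Tt] at this
        rw [this]
        exact Submodule.smul_mem _ _ ih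
      · exact T_s_mul_mem_symAnnihilator hn cs hi ih

/-- The preimage under bar passes the test of `le_symAnnihilator`: bar turns T_s into T_s⁻¹, which
also preserves the annihilator, and turns T_t into T_t⁻¹, which acts there as V⁻¹, the conjugate of
V. -/
theorem bar_mem_symAnnihilator {h : HeckeB hn cs} (hh : h ∈ symAnnihilator hn cs) :
    bar (weightB hn cs) h ∈ symAnnihilator hn cs := by
  have hP : barPreimage (weightB hn cs) (symAnnihilator hn cs) ≤ symAnnihilator hn cs := by
    apply le_symAnnihilator
    · intro i hi h hh
      rw [mem_barPreimage] at hh ⊢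
      rw [bar_T_simple_mul]
      exact Tinv_mul_mem_symAnnihilator hn cs hi hh
    · intro h hh
      rw [mem_barPreimage] at hh
      have h1 := Tt_mul_of_mem_symAnnihilator hn cs hh
      have h2 : bar (weightB hn cs) (Tt hn cs * h) = Vinv • bar (weightB hn cs) h := by
        rw [Tt] at h1 ⊢
        rw [bar_T_simple_mul, Tinv_mul_eq, h1, xi_t, ← sub_smul, sub_sub_cancel]
      rw [← bar_bar (weightB hn cs) (Tt hn cs * h), h2, bar_smul, groundBar_Vinv, bar_bar]
  apply hP
  rwa [mem_barPreimage, bar_bar]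

theorem murphyProd_mem_symAnnihilator : murphyProd hn cs n ∈ symAnnihilator hn cs := by
  intro x hx
  have hc : Commute x (murphyProd hn cs n) := by
    induction hx using Algebra.adjoin_induction with
    | mem x hx =>
      obtain ⟨i, hi, rfl⟩ := hx
      obtain ⟨j, hj, rfl⟩ := exists_eq_nodeIndex hn i
      refine nodeT_commute_murphyProd hn cs (Nat.pos_of_ne_zero ?_) hj le_rfl
      rintro rfl
      exact hi (nodeIndex_zero hn)
    | algebraMap r => exact Algebra.commute_algebraMap_left _ _
    | add x y _ _ hx hy => exact hx.add_left hy
    | mul x y _ _ hx hy => exact hx.mul_left hy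
  rw [mul_assoc, hc.eq, ← mul_assoc, Tt_sub_mul_murphyProd hn cs hn le_rfl, zero_mul]

/-- Membership of the coefficients of `h` on the `T_w` with `ℓ_t(w) = n - k` in a family of
subgroups propagates from `k = 0`. -/
theorem coord_mem_of_mem_symAnnihilator (D : ℕ → AddSubgroup (Ground (ℤ ×ₗ ℤ)))
    (hxi : ∀ k, ∀ i ≠ tIndex hn, ∀ a ∈ D k, xi (weightB hn cs) i * a ∈ D k)
    (hV : ∀ k, ∀ a ∈ D k, Vinv * a ∈ D (k + 1)) {h : HeckeB hn cs}
    (hh : h ∈ symAnnihilator hn cs)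
    (hD : ∀ w, lengthT hn cs w = n → coord (weightB hn cs) h w ∈ D 0) {k : ℕ} {w : W}
    (hw : lengthT hn cs w + k = n) : coord (weightB hn cs) h w ∈ D k := by
  induction k generalizing h w with
  | zero => exact hD w hw
  | succ k ih =>
    obtain ⟨ω, hω, hlt⟩ := exists_length_lt_t_mul hn cs (w := w) (by omega)
    induction ω using List.reverseRecOn generalizing h w with
    | nil =>
      rw [cs.wordProd_nil, one_mul] at hlt
      -- Here tw > w, so the coefficient of T_w in T_t h = V h reads h_{tw} = V h_w.
      have h1 := congrArg (fun x => coord (weightB hn cs) x w)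
        (Tt_mul_of_mem_symAnnihilator hn cs hh)
      rw [Tt, coord_T_simple_mul, if_neg (by omega), add_zero, coord_smul] at h1
      have h2 := hV k _ (ih hh hD (w := cs.simple (tIndex hn) * w)
        (by rw [lengthT_t_mul hn cs hlt]; omega))
      rwa [h1, ← mul_assoc, Vinv_mul_V, one_mul] at h2
    | append_singleton ω i ihω =>
      have hi : i ≠ tIndex hn := hω i (by simp)
      have hω' : ∀ j ∈ ω, j ≠ tIndex hn := fun j hj => hω j (by simp [hj])
      rw [cs.wordProd_append, cs.wordProd_singleton, mul_assoc] at hlt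
      have hl : lengthT hn cs (cs.simple i * w) + (k + 1) = n := by
        rw [lengthT_simple_mul hn cs hi, hw]
      have h1 := ihω hh hD hl hω' hlt
      -- The inductive claim at sw is applied to T_s h as well as to h: the coefficient of T_s h at
      -- sw is that of h at w, plus possibly ξ_s times that of h at sw. This is why h varies in the
      -- induction.
      have h2 := ihω (T_s_mul_mem_symAnnihilator hn cs hi hh) (by
        intro y hy
        rw [coord_T_simple_mul]
        apply add_mem (hD _ (by rwa [lengthT_simple_mul hn cs hi]))
        split_ifs
        · exact hxi _ _ hi _ (hD y hy)
        · exact zero_mem _) hl hω' hlt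
      rw [coord_T_simple_mul, cs.simple_mul_simple_cancel_left] at h2
      have h3 := sub_mem h2 (show (if cs.length w < cs.length (cs.simple i * w) then
          xi (weightB hn cs) i * coord (weightB hn cs) h (cs.simple i * w) else 0) ∈ D (k + 1) by
        split_ifs
        · exact hxi _ _ hi _ h1
        · exact zero_mem _)
      rwa [add_sub_cancel_right] at h3

/-- An element of the annihilator is determined by its coefficients on the `T_w` with
`ℓ_t(w) = n`. -/
theorem eq_zero_of_mem_symAnnihilator {h : HeckeB hn cs} (hh : h ∈ symAnnihilator hn cs)
    (h0 : ∀ w, lengthT hn cs w = n → coord (weightB hn cs) h w = 0) : h = 0 := by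
  apply eq_zero_of_coord
  intro w
  -- The propagation is applied with all subgroups zero.
  have := coord_mem_of_mem_symAnnihilator hn cs (fun _ => ⊥) (by simp) (by simp) hh
    (by simpa using h0) (k := n - lengthT hn cs w) (w := w)
    (Nat.add_sub_of_le (lengthT_le hn cs w))
  simpa using this

theorem xi_mul_mem_vDegLE {i : Fin n} (hi : i ≠ tIndex hn) {d : ℤ} {a : Ground (ℤ ×ₗ ℤ)}
    (ha : a ∈ vDegLE d) : xi (weightB hn cs) i * a ∈ vDegLE d := by
  rw [xi, weightB_s hn cs hi, sub_mul]
  exact sub_mem (vpow_mul_mem_vDegLE ha _ (by simp)) (vpow_mul_mem_vDegLE ha _ (by simp))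

/-- The propagation is applied to the bound -k on the V-degree: ξ_s has degree 0 in V for s ≠ t, and
V⁻¹ lowers the bound by one. -/
theorem isNegative_coord_of_mem_symAnnihilator {h : HeckeB hn cs}
    (hh : h ∈ symAnnihilator hn cs)
    (hD : ∀ w, lengthT hn cs w = n → coord (weightB hn cs) h w ∈ vDegLE 0) {w : W}
    (hw : lengthT hn cs w ≠ n) : IsNegative (coord (weightB hn cs) h w) := by
  have hle := lengthT_le hn cs w
  refine isNegative_of_mem_vDegLE (coord_mem_of_mem_symAnnihilator hn cs
    (fun k => vDegLE (-(k : ℤ))) (fun k i hi a ha => xi_mul_mem_vDegLE hn cs hi ha) ?_ hh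
    (by simpa using hD) (k := n - lengthT hn cs w) (Nat.add_sub_of_le hle)) (by omega)
  intro k a ha
  exact vpow_mul_mem_vDegLE ha _ (by simp)

/-! ### Elements of the annihilator with prescribed leading terms. -/

theorem Tinv_mul_mem_lowT {k : ℕ} {i : Fin n} (hi : i ≠ tIndex hn) {x : HeckeB hn cs}
    (hx : x ∈ lowT hn cs k) : Tinv (weightB hn cs) i * x ∈ lowT hn cs k := by
  rw [Tinv_mul_eq]
  exact sub_mem (T_s_mul_mem_lowT hn cs hi hx) (Submodule.smul_mem _ _ hx)

theorem bar_T_mem_lowT {k : ℕ} {w : W} (hw : lengthT hn cs w < k) :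
    bar (weightB hn cs) (T (weightB hn cs) w) ∈ lowT hn cs k := by
  obtain ⟨ω, hω, rfl⟩ := cs.exists_isReduced w
  rw [lengthT_wordProd hn cs hω] at hw
  rw [T_wordProd _ hω]
  refine lowT_mono hn cs hw ?_
  clear hω hw
  induction ω with
  | nil =>
    rw [List.map_nil, List.prod_nil, bar_one, one_def]
    apply T_mem_lowT
    rw [← cs.wordProd_nil, lengthT_wordProd hn cs (by simp [CoxeterSystem.IsReduced])]
    simp
  | cons i ω ih =>
    rw [List.map_cons, List.prod_cons, bar_T_simple_mul]
    by_cases hi : i = tIndex hn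
    · subst hi
      rw [List.count_cons_self, Tinv_mul_eq]
      exact sub_mem (Tt_mul_mem_lowT hn cs ih)
        (Submodule.smul_mem _ _ (lowT_mono hn cs (Nat.le_succ _) ih))
    · rw [List.count_cons_of_ne hi]
      exact Tinv_mul_mem_lowT hn cs hi ih

theorem coord_eq_of_sub_mem_lowT {x y : HeckeB hn cs} (h : x - y ∈ lowT hn cs n) {w : W}
    (hw : lengthT hn cs w = n) : coord (weightB hn cs) x w = coord (weightB hn cs) y w := by
  have := h w hw.ge
  rwa [coord_sub, sub_eq_zero] at this

/-- For every `w` with `ℓ_t(w) = n` the annihilator contains an element congruent to `T_w`. -/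
theorem exists_mem_symAnnihilator {w : W} (hw : lengthT hn cs w = n) :
    ∃ e ∈ symAnnihilator hn cs, e - T (weightB hn cs) w ∈ lowT hn cs n := by
  obtain ⟨ω, hω, rfl⟩ := exists_eq_wordProd_mul hn cs hw (lengthT_signWord hn cs)
  clear hw
  induction ω with
  | nil =>
    rw [cs.wordProd_nil, one_mul]
    exact ⟨_, murphyProd_mem_symAnnihilator hn cs, murphyProd_sub_mem_lowT hn cs le_rfl⟩
  | cons i ω ih =>
    have hi : i ≠ tIndex hn := hω i (by simp)
    obtain ⟨e, he, hlow⟩ := ih (fun j hj => hω j (by simp [hj]))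
    rw [cs.wordProd_cons, mul_assoc]
    set w := cs.wordProd ω * cs.wordProd (signWord hn n)
    rcases Nat.lt_or_ge (cs.length w) (cs.length (cs.simple i * w)) with h | h
    · refine ⟨_, T_s_mul_mem_symAnnihilator hn cs hi he, ?_⟩
      rw [← T_simple_mul_up _ h, ← mul_sub]
      exact T_s_mul_mem_lowT hn cs hi hlow
    -- When s shortens w, T_{sw} = T_s⁻¹ T_w, so the inverse is applied instead.
    · have h' : cs.length (cs.simple i * w) < cs.length w :=
        lt_of_le_of_ne h (cs.length_simple_mul_ne w i)
      have h1 := T_simple_mul_up (weightB hn cs) (i := i) (w := cs.simple i * w)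
        (by simpa using h')
      rw [cs.simple_mul_simple_cancel_left] at h1
      refine ⟨_, Tinv_mul_mem_symAnnihilator hn cs hi he, ?_⟩
      rw [← one_mul (T (weightB hn cs) (cs.simple i * w)), ← Tinv_mul_T _ i, mul_assoc, h1,
        ← mul_sub]
      exact Tinv_mul_mem_lowT hn cs hi hlow

/-- Representatives are required only on the support of `f`, so that the lemma can be used inside an
induction on the length, where only shorter elements are available. -/
theorem exists_mem_of_coord {S : Submodule (Ground (ℤ ×ₗ ℤ)) (HeckeB hn cs)}
    (f : W →₀ Ground (ℤ ×ₗ ℤ))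
    (hS : ∀ w, lengthT hn cs w = n → f w ≠ 0 →
      ∃ e ∈ S, e - T (weightB hn cs) w ∈ lowT hn cs n) :
    ∃ x ∈ S, ∀ w, lengthT hn cs w = n → coord (weightB hn cs) x w = f w := by
  classical
  induction f using Finsupp.induction with
  | zero => exact ⟨0, zero_mem _, fun w _ => coord_zero _ w⟩
  | single_add y b f hy hb ih =>
    have hfy : f y = 0 := Finsupp.notMem_support_iff.mp hy
    obtain ⟨x, hx, hx'⟩ := ih (by
      intro w hw hf
      apply hS w hw
      have hne : y ≠ w := by rintro rfl; exact hf hfy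
      rwa [Finsupp.add_apply, Finsupp.single_eq_of_ne' hne, zero_add])
    by_cases hyn : lengthT hn cs y = n
    · obtain ⟨e, he, he'⟩ := hS y hyn (by
        rwa [Finsupp.add_apply, Finsupp.single_eq_same, hfy, add_zero])
      refine ⟨b • e + x, add_mem (Submodule.smul_mem _ _ he) hx, ?_⟩
      intro w hw
      rw [coord_add, coord_smul, coord_eq_of_sub_mem_lowT hn cs he' hw, hx' w hw,
        Finsupp.add_apply, coord_T, Finsupp.single_apply]
      congr 1
      split_ifs <;> simp
    · refine ⟨x, hx, ?_⟩
      intro w hw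
      have hne : y ≠ w := by rintro rfl; exact hyn hw
      rw [hx' w hw, Finsupp.add_apply, Finsupp.single_eq_of_ne' hne, zero_add]

/-! ### Kazhdan–Lusztig elements inside the annihilator. -/

theorem coord_bar_eq_of_lengthT {x : HeckeB hn cs} {y : W} (hy : lengthT hn cs y = n)
    (h : ∀ w, lengthT hn cs w = n → coord (weightB hn cs) x w ≠ 0 →
      cs.length w ≤ cs.length y) :
    coord (weightB hn cs) (bar (weightB hn cs) x) y = groundBar (coord (weightB hn cs) x y) := by
  apply coord_bar_eq
  intro w hwy hw
  by_cases hwn : lengthT hn cs w = n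
  · exact coord_bar_T_of_ne _ (h w hwn hw) hwy
  · exact bar_T_mem_lowT hn cs (lt_of_le_of_ne (lengthT_le hn cs w) hwn) y hy.ge

/-- This is the correction step of the Kazhdan–Lusztig construction, carried out on coefficients
with ℓ_t = n and by layers of decreasing length. On the longest layer bar acts as `groundBar`, so
the coefficients of d are anti-invariant there; an element p of N with their negative parts as
coefficients removes that layer from d. -/
theorem exists_sub_bar_eq (k : ℕ) {d : HeckeB hn cs} (hd : d ∈ symAnnihilator hn cs)
    (hb : bar (weightB hn cs) d = -d)
    (hk : ∀ y, lengthT hn cs y = n → coord (weightB hn cs) d y ≠ 0 → cs.length y < k) :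
    ∃ p ∈ symAnnihilator hn cs, p - bar (weightB hn cs) p = d ∧
      ∀ y, lengthT hn cs y = n → IsNegative (coord (weightB hn cs) p y) ∧
        (coord (weightB hn cs) p y ≠ 0 → cs.length y < k) := by
  classical
  induction k generalizing d with
  | zero =>
    have : d = 0 := eq_zero_of_mem_symAnnihilator hn cs hd (by
      intro y hy
      by_contra h
      exact absurd (hk y hy h) (by omega))
    refine ⟨0, zero_mem _, by rw [bar_zero, sub_zero, this], fun y _ => ?_⟩
    rw [coord_zero]
    exact ⟨isNegative_zero, fun h => absurd rfl h⟩
  | succ k ih =>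
    let f : W →₀ Ground (ℤ ×ₗ ℤ) :=
      (((basis (weightB hn cs)).repr d).mapRange negativePart negativePart_zero).filter
        (fun w => cs.length w = k)
    have hf : ∀ w, f w = if cs.length w = k then
        negativePart (coord (weightB hn cs) d w) else 0 := by
      intro w
      simp only [f, Finsupp.filter_apply, Finsupp.mapRange_apply]
      rfl
    obtain ⟨p, hp, hpf⟩ := exists_mem_of_coord hn cs (S := symAnnihilator hn cs) f
      (fun w hw _ => exists_mem_symAnnihilator hn cs hw)
    obtain ⟨q, hq, hqd, hqn⟩ := ih (d := d - (p - bar (weightB hn cs) p))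
      (sub_mem hd (sub_mem hp (bar_mem_symAnnihilator hn cs hp)))
      (by rw [bar_sub, bar_sub, bar_bar, hb]; abel) (by
        intro y hy hne
        by_contra hlt
        apply hne
        rw [coord_sub, coord_sub, coord_bar_eq_of_lengthT hn cs hy (by
          intro w hw hne
          rw [hpf w hw, hf] at hne
          have : cs.length w = k := by
            by_contra h
            exact hne (if_neg h)
          omega), hpf y hy, hf]
        rcases Nat.eq_or_lt_of_not_lt hlt with h | h
        · have h1 := coord_bar_eq_of_lengthT hn cs (x := d) hy (by
            intro w hw hne
            have := hk w hw hne
            omega)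
          rw [hb, ← zero_sub, coord_sub, coord_zero, zero_sub] at h1
          rw [if_pos h, negativePart_sub_bar h1.symm, sub_self]
        · have h1 : coord (weightB hn cs) d y = 0 := by
            by_contra h'
            have := hk y hy h'
            omega
          rw [h1, if_neg (by omega), map_zero]
          simp)
    refine ⟨p + q, add_mem hp hq, ?_, ?_⟩
    · rw [bar_add, add_sub_add_comm, hqd]; abel
    · intro y hy
      rw [coord_add, hpf y hy, hf]
      obtain ⟨h1, h2⟩ := hqn y hy
      split_ifs with h
      · have h3 : coord (weightB hn cs) q y = 0 := by
          by_contra h'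
          have := h2 h'
          omega
        rw [h3, add_zero]
        exact ⟨isNegative_negativePart _, fun _ => by omega⟩
      · rw [zero_add]
        exact ⟨h1, fun h' => (h2 h').trans (Nat.lt_succ_self k)⟩

/-- The Kazhdan--Lusztig elements `C_w` with `ℓ_t(w) = n` lie in the annihilator. -/
theorem exists_isKazhdanLusztig {w : W} (hw : lengthT hn cs w = n) :
    ∃ c ∈ symAnnihilator hn cs, IsKazhdanLusztig (weightB hn cs) w c ∧
      ∀ y, lengthT hn cs y = n →
        coord (weightB hn cs) (c - T (weightB hn cs) w) y ≠ 0 → cs.length y < cs.length w := by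
  obtain ⟨e, he, hlow⟩ := exists_mem_symAnnihilator hn cs hw
  have hcoord : ∀ y, lengthT hn cs y = n → coord (weightB hn cs) e y =
      coord (weightB hn cs) (T (weightB hn cs) w) y :=
    fun y hy => coord_eq_of_sub_mem_lowT hn cs hlow hy
  -- The relation p - bar p = bar e - e says that e + p is bar-invariant. The bound ℓ(w) is valid
  -- because the only coefficient of e with ℓ_t = n is 1, at w.
  obtain ⟨p, hp, hpd, hpn⟩ := exists_sub_bar_eq hn cs (cs.length w)
    (d := bar (weightB hn cs) e - e)
    (sub_mem (bar_mem_symAnnihilator hn cs he) he) (by rw [bar_sub, bar_bar, neg_sub]) (by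
      intro y hy hne
      by_contra hlt
      apply hne
      rw [coord_sub, coord_bar_eq_of_lengthT hn cs hy, hcoord y hy]
      · classical
        rw [coord_T]
        split_ifs <;> simp
      · intro z hz hne
        rw [hcoord z hz] at hne
        by_cases hwz : w = z
        · subst hwz; omega
        · exact absurd (coord_T_of_ne _ hwz) hne)
  have hcp : ∀ y, lengthT hn cs y = n →
      coord (weightB hn cs) (e + p - T (weightB hn cs) w) y = coord (weightB hn cs) p y := by
    intro y hy
    rw [coord_sub, coord_add, hcoord y hy, add_sub_cancel_left]
  refine ⟨e + p, add_mem he hp, ⟨?_, ?_⟩, ?_⟩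
  · have : bar (weightB hn cs) p = p - (bar (weightB hn cs) e - e) := by rw [← hpd]; abel
    rw [bar_add, this]; abel
  · intro y
    by_cases hy : lengthT hn cs y = n
    · rw [hcp y hy]
      exact (hpn y hy).1
    · have hwy : w ≠ y := by rintro rfl; exact hy hw
      rw [coord_sub, coord_T_of_ne _ hwy, sub_zero]
      -- Below ℓ_t = n negativity follows from membership in N, once the coefficients with ℓ_t = n
      -- have V-degree at most 0.
      refine isNegative_coord_of_mem_symAnnihilator hn cs (add_mem he hp) ?_ hy
      intro z hz
      rw [coord_add, hcoord z hz]
      refine add_mem ?_ (hpn z hz).1.mem_vDegLE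
      classical
      rw [coord_T]
      split_ifs
      · exact one_mem_vDegLE
      · exact zero_mem _
  · intro y hy hne
    rw [hcp y hy] at hne
    exact (hpn y hy).2 hne

/-- Among coefficients with ℓ_t = n, C_w - T_w involves only elements shorter than w. Induction on
the length inverts this unitriangular system. -/
theorem exists_mem_inf_spanC {w : W} (hw : lengthT hn cs w = n) :
    ∃ e ∈ symAnnihilator hn cs ⊓ spanC hn cs n, e - T (weightB hn cs) w ∈ lowT hn cs n := by
  induction hk : cs.length w using Nat.strong_induction_on generalizing w with
  | _ k ih =>
    obtain ⟨c, hc, hkl, hlen⟩ := exists_isKazhdanLusztig hn cs hw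
    obtain ⟨x, hx, hxf⟩ := exists_mem_of_coord hn cs (S := symAnnihilator hn cs ⊓ spanC hn cs n)
      ((basis (weightB hn cs)).repr (c - T (weightB hn cs) w)) (by
        intro y hy hne
        exact ih (cs.length y) (hk ▸ hlen y hy hne) hy rfl)
    refine ⟨c - x, sub_mem ⟨hc, Submodule.subset_span ⟨w, hw, hkl⟩⟩ hx, ?_⟩
    intro y hy
    have hy' : lengthT hn cs y = n := le_antisymm (lengthT_le hn cs y) hy
    rw [sub_right_comm, coord_sub, hxf y hy']
    exact sub_self _

/-- A combination of Kazhdan–Lusztig elements in N matches h on ℓ_t = n, and an element of N is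
determined by those coefficients. The reverse inclusion is uniqueness of C_w. -/
theorem symAnnihilator_eq_spanC : symAnnihilator hn cs = spanC hn cs n := by
  apply le_antisymm
  · intro h hh
    obtain ⟨x, hx, hxf⟩ := exists_mem_of_coord hn cs (S := symAnnihilator hn cs ⊓ spanC hn cs n)
      ((basis (weightB hn cs)).repr h) (fun w hw _ => exists_mem_inf_spanC hn cs hw)
    have : h - x = 0 := eq_zero_of_mem_symAnnihilator hn cs (sub_mem hh hx.1) (by
      intro w hw
      rw [coord_sub, hxf w hw]
      exact sub_self _)
    rw [sub_eq_zero.mp this]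
    exact hx.2
  · rw [spanC, Submodule.span_le]
    rintro c ⟨w, hw, hc⟩
    obtain ⟨c', hc', hkl, -⟩ := exists_isKazhdanLusztig hn cs hw
    rw [hc.unique _ hkl]
    exact hc'

end Annihilator

end CoxeterHecke

theorem proposition2p2 {n : ℕ} (hn : 1 ≤ n) {W : Type*} [Group W]
    (cs : CoxeterSystem (CoxeterMatrix.B n) W) (h : CoxeterHecke.HeckeB hn cs) :
    List.TFAE [
      h ∈ CoxeterHecke.spanC hn cs n,
      ∀ x : CoxeterHecke.HeckeB hn cs,
        (CoxeterHecke.Tt hn cs - algebraMap _ _ CoxeterHecke.V) * x * h = 0,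
      ∀ x ∈ CoxeterHecke.heckeSym hn cs,
        (CoxeterHecke.Tt hn cs - algebraMap _ _ CoxeterHecke.V) * x * h = 0] := by
  rw [← CoxeterHecke.symAnnihilator_eq_spanC]
  tfae_have 1 → 2 := by
    intro hh x
    -- The element x h lies in the left ideal N again; its defining condition is used at 1.
    have := CoxeterHecke.mul_mem_symAnnihilator hn cs x hh 1 (one_mem _)
    rwa [mul_one, ← mul_assoc] at this
  tfae_have 2 → 3 := fun hh x _ => hh x
  tfae_have 3 → 1 := id
  tfae_finish
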